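/- **Model.** Finitely many jobs $j$ with release times $a_j\in\mathbb R$ and sizes $w_j>0$ are to be processed on $m\ge 1$ identical servers of adjustable speed. A server running at speed $s\ge 0$ does work at rate $s$ and consumes power $P(s)$; idle servers run at speed $0$. A schedule decides (measurably in time) which released job each server processes and at which speed; preemption and migration between servers are allowed, but at any time a job is processed by at most one server. A job is complete once the total work done on it equals $w_j$. Writing $n(t)$ for the number of released and incomplete jobs and $s_k(t)$ for the speed of server $k$ at time $t$, the cost (flow time plus energy) of a schedule is $$C=\int n(t)\,dt+\int\sum_{k=1}^m P(s_k(t))\,dt .$$ Let $C_{\mathsf{OPT}}(\sigma)$ be the infimum of the cost over all schedules of the input $\sigma=(a_j,w_j)_j$, chosen with full knowledge of $\sigma$. An online algorithm $A$ is $c$-competitive if $C_A(\sigma)\le c\,C_{\mathsf{OPT}}(\sigma)$ for every input $\sigma$. **Algorithm.** Multi-server SRPT serves, at every time $t$, $\min\{m,n(t)\}$ incomplete released jobs of smallest remaining size (ties broken arbitrarily), and each busy server runs at speed $P^{-1}(n(t)/m)$ if $n(t)\ge m$ and $P^{-1}(1)$ if $n(t)<m$. **Theorem.** Let $P:[0,\infty)\to[0,\infty)$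 with $P(0)=0$ be differentiable, strictly increasing and strictly convex, and suppose that $P(xy)\le P(x)P(y)$ for all $x,y>0$. Then $P$ is a bijection of $[0,\infty)$ onto itself, the set $\{s>0: P(s)>s\}$ is non-empty, and, with $\bar s=\inf\{s>0: P(s)>s\}$, for every $m\ge1$ the SRPT algorithm above can be run on every input and (however ties are broken) is $c$-competitive with $$c=P\!\left(2-\tfrac1m\right)\left(2+\frac{2}{P^{-1}(1)}\max\bigl(1,P(\bar s)\bigr)\right).$$ In particular, for $P(s)=s^\alpha$ with $\alpha>1$ this constant equals $4\left(2-\tfrac1m\right)^{\alpha}$, so SRPT is $4\left(2-\tfrac1m\right)^{\alpha}$-competitive. -/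

import Mathlib

open MeasureTheory Set
open scoped ENNReal

noncomputable section

/-- Standing assumptions on the power function `P : [0, ∞) → [0, ∞)`. -/
structure IsPowerFunction (P : ℝ → ℝ) : Prop where
  map_zero : P 0 = 0
  differentiableOn : DifferentiableOn ℝ P (Ici 0)
  strictMonoOn : StrictMonoOn P (Ici 0)
  strictConvexOn : StrictConvexOn ℝ (Ici 0) P
  submultiplicative : ∀ x y : ℝ, 0 < x → 0 < y → P (x * y) ≤ P x * P y

/-- The inverse `P⁻¹` of the power function, as a function on `[0, ∞)`. -/
def powerInv (P : ℝ → ℝ) (y : ℝ) : ℝ := Function.invFunOn P (Ici 0) y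

/-- The set `{s > 0 | P(s) > s}`. -/
def superlinearSpeeds (P : ℝ → ℝ) : Set ℝ := {s : ℝ | 0 < s ∧ s < P s}

/-- `s̄ = inf {s > 0 | P(s) > s}`. -/
def sBar (P : ℝ → ℝ) : ℝ := sInf (superlinearSpeeds P)

/-- A finite sequence of `J` jobs with release times and positive sizes. -/
structure JobSequence (J : ℕ) where
  arrival : Fin J → ℝ
  size : Fin J → ℝ
  size_pos : ∀ j, 0 < size j

/-- A preemptive schedule, with migration, of the given jobs on `m` speed-scalable servers.
`job k t` is the job that server `k` processes at time `t` (`none` if it is idle), and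
`speed k t` is its speed. There is no causality requirement. -/
structure Schedule {J : ℕ} (I : JobSequence J) (m : ℕ) where
  job : Fin m → ℝ → Option (Fin J)
  speed : Fin m → ℝ → ℝ
  measurableSet_job : ∀ k j, MeasurableSet {t : ℝ | job k t = some j}
  measurable_speed : ∀ k, Measurable (speed k)
  speed_nonneg : ∀ k t, 0 ≤ speed k t
  /-- idle servers run at speed zero -/
  speed_idle : ∀ k t, job k t = none → speed k t = 0
  /-- only released jobs are processed -/
  released : ∀ k t j, job k t = some j → I.arrival j ≤ t
  /-- no job is processed by two servers at the same time -/
  no_split : ∀ k k' t j, job k t = some j → job k' t = some j → k = k'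

namespace Schedule

variable {J : ℕ} {I : JobSequence J} {m : ℕ}

/-- Amount of work done on job `j` up to time `t`, by all the servers together. -/
def work (S : Schedule I m) (j : Fin J) (t : ℝ) : ℝ≥0∞ :=
  ∫⁻ u in Iic t, ∑ k, if S.job k u = some j then ENNReal.ofReal (S.speed k u) else 0

/-- Remaining size of job `j` at time `t`. -/
def remaining (S : Schedule I m) (j : Fin J) (t : ℝ) : ℝ≥0∞ :=
  ENNReal.ofReal (I.size j) - S.work j t

open Classical in
/-- The jobs that are released by time `t` and not yet complete at time `t`. -/
def unfinished (S : Schedule I m) (t : ℝ) : Finset (Fin J) :=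
  Finset.univ.filter fun j => I.arrival j ≤ t ∧ S.work j t < ENNReal.ofReal (I.size j)

/-- The jobs that are processed at time `t`. -/
def served (S : Schedule I m) (t : ℝ) : Finset (Fin J) :=
  Finset.univ.filter fun j => ∃ k, S.job k t = some j

/-- `n(t)`, the number of unfinished jobs at time `t`. -/
def numUnfinished (S : Schedule I m) (t : ℝ) : ℕ := (S.unfinished t).card

/-- Flow time plus energy, `∫ n(t) dt + ∫ ∑ₖ P(sₖ(t)) dt`. -/
def cost (P : ℝ → ℝ) (S : Schedule I m) : ℝ≥0∞ :=
  (∫⁻ t, (S.numUnfinished t : ℝ≥0∞)) + ∫⁻ t, ∑ k, ENNReal.ofReal (P (S.speed k t))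

end Schedule

/-- Speed of a busy server when `n` jobs are unfinished. -/
def speedRule (P : ℝ → ℝ) (m n : ℕ) : ℝ :=
  if m ≤ n then powerInv P ((n : ℝ) / (m : ℝ)) else powerInv P 1

/-- `S` is a run of multi-server SRPT with the above speeds: at every time, `min {m, n(t)}`
unfinished jobs of least remaining size are served (ties are broken arbitrarily), and every
busy server runs at the prescribed speed. -/
structure Schedule.IsSRPT {J : ℕ} {I : JobSequence J} {m : ℕ} (P : ℝ → ℝ)
    (S : Schedule I m) : Prop where
  served_subset : ∀ t, S.served t ⊆ S.unfinished t
  card_served : ∀ t, (S.served t).card = min m (S.numUnfinished t)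
  shortest : ∀ t, ∀ i ∈ S.served t, ∀ j ∈ S.unfinished t, j ∉ S.served t →
    S.remaining i t ≤ S.remaining j t
  speed_eq : ∀ t k, S.job k t ≠ none → S.speed k t = speedRule P m (S.numUnfinished t)

/-- The offline optimal flow time plus energy on `m` servers. -/
def optCost (P : ℝ → ℝ) (m : ℕ) {J : ℕ} (I : JobSequence J) : ℝ≥0∞ :=
  ⨅ S : Schedule I m, S.cost P

/-- SRPT is `c`-competitive on `m` servers: on every input it can be run, and however ties are
broken, its cost is at most `c` times the offline optimum. -/
def SRPTIsCompetitive (P : ℝ → ℝ) (m : ℕ) (c : ℝ) : Prop :=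
  ∀ (J : ℕ) (I : JobSequence J),
    (∃ S : Schedule I m, S.IsSRPT P) ∧
      ∀ S : Schedule I m, S.IsSRPT P → S.cost P ≤ ENNReal.ofReal c * optCost P m I

/-- `P(2 - 1/m) (2 + (2 / P⁻¹(1)) max(1, P(s̄)))`. -/
def srptRatio (P : ℝ → ℝ) (m : ℕ) : ℝ :=
  P (2 - 1 / (m : ℝ)) * (2 + 2 / powerInv P 1 * max 1 (P (sBar P)))

end

/-! At every time an SRPT run consumes power exactly `n(t)`, so its cost is twice its flow time. It
therefore suffices to bound that flow time by `(C + σ)` times the cost of an arbitrary schedule `O`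
of finite cost, with `2 * (C + σ) ≤ srptRatio P m`.

The schedule `O` is compared through a virtual state `z`: a single server that runs at the total
speed of `O` and always drains the shortest released job. Draining the shortest job is the best use
of a given amount of work, so `z` stays ahead of `O` in the sense of `Dominates`; in particular it
has at most as many positive entries as `O` has unfinished jobs. The energy of `O` is still charged
on `m` servers.

The potential is `Φ = ∫ G (N q - M q) dq`, where `N q` and `M q` count the jobs with more than `q`
left under SRPT and in `z`, and `G` is the discrete primitive of a nondecreasing weight `g` that
vanishes on nonpositive integers. A new job has the same size in both states, so arrivals leave `Φ`
unchanged. With `n` and `n'` positive entries and `a = min m n` jobs served, each unit of SRPT work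
lowers `Φ` by at least `g (j - a + 1)` and each unit of work in `z` raises it by at most `g j`,
where `j` is `n - n'` or `n - n' + 1` (`exists_potential_move_le`). `IsDriftWeight` asks that a
supporting line convert `g j` times the speed into energy of `O` and that the remaining terms
balance. For `m = 1` the weights are subgradients of `P`; for `m ≥ 2` they are chord slopes of `P`
scaled by `P (2 - 1 / m)`, controlled by `chord_le`.

The extra term `σ` times the remaining SRPT work makes up for the shift from `j` to `j - a + 1` when
`m ≥ 2`. It starts at `σ` times the total size, which is at most `σ` times the cost of `O` because
`s ≤ 1 + P s`.

Speeds in `O` are merely measurable, so the drift is integrated instead of differentiated, over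
intervals with no arrival or SRPT completion in their interior and on which `z` drains one job. On
such an interval SRPT serves a constant set of jobs however ties are broken (`exists_served_eq`). -/

namespace IsPowerFunction

/-! ### The power function and its inverse -/

variable {P : ℝ → ℝ}

theorem nonneg (hP : IsPowerFunction P) {s : ℝ} (hs : 0 ≤ s) : 0 ≤ P s := by
  have := hP.strictMonoOn.monotoneOn (mem_Ici.2 le_rfl) (mem_Ici.2 hs) hs
  rwa [hP.map_zero] at this

theorem pos (hP : IsPowerFunction P) {s : ℝ} (hs : 0 < s) : 0 < P s := by
  have := hP.strictMonoOn (mem_Ici.2 le_rfl) (mem_Ici.2 hs.le) hs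
  rwa [hP.map_zero] at this

theorem one_le_map_one (hP : IsPowerFunction P) : 1 ≤ P 1 := by
  have h := hP.submultiplicative 1 1 one_pos one_pos
  have h1 := hP.pos one_pos
  rw [one_mul] at h
  nlinarith

theorem mul_le_map_mul (hP : IsPowerFunction P) {κ s : ℝ} (hκ : 1 ≤ κ) (hs : 0 ≤ s) :
    κ * P s ≤ P (κ * s) := by
  have hκ0 : 0 < κ := by linarith
  have h := hP.strictConvexOn.convexOn.2 (mem_Ici.2 (le_refl (0 : ℝ)))
    (mem_Ici.2 (mul_nonneg hκ0.le hs)) (sub_nonneg.2 (inv_le_one_of_one_le₀ hκ))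
    (inv_nonneg.2 hκ0.le) (by ring)
  rw [hP.map_zero] at h
  simp only [smul_eq_mul, mul_zero, zero_add] at h
  rw [inv_mul_cancel_left₀ hκ0.ne'] at h
  calc κ * P s ≤ κ * (κ⁻¹ * P (κ * s)) := by gcongr
    _ = P (κ * s) := by field_simp

theorem le_map (hP : IsPowerFunction P) {s : ℝ} (hs : 1 ≤ s) : s ≤ P s := by
  have h := hP.mul_le_map_mul hs zero_le_one
  rw [mul_one] at h
  nlinarith [hP.one_le_map_one]

/-- This is why work is never cheaper than `1` per unit: the `1` is the flow time of the processed
job, `P s` its energy. -/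
theorem le_one_add_map (hP : IsPowerFunction P) {s : ℝ} (hs : 0 ≤ s) : s ≤ 1 + P s := by
  rcases le_total 1 s with h | h
  · linarith [hP.le_map h]
  · linarith [hP.nonneg hs]

theorem bijOn (hP : IsPowerFunction P) : BijOn P (Ici 0) (Ici 0) := by
  refine ⟨fun s hs => hP.nonneg hs, hP.strictMonoOn.injOn, fun y hy => ?_⟩
  have hy0 : (0 : ℝ) ≤ y := hy
  have h1 : (0 : ℝ) ≤ max 1 y := zero_le_one.trans (le_max_left _ _)
  have hc : ContinuousOn P (Icc 0 (max 1 y)) :=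
    hP.differentiableOn.continuousOn.mono Icc_subset_Ici_self
  obtain ⟨s, hs, rfl⟩ := intermediate_value_Icc h1 hc
    ⟨by rwa [hP.map_zero], (le_max_right 1 y).trans (hP.le_map (le_max_left _ _))⟩
  exact ⟨s, hs.1, rfl⟩

theorem two_mem_superlinearSpeeds (hP : IsPowerFunction P) : 2 ∈ superlinearSpeeds P := by
  refine ⟨two_pos, ?_⟩
  have h := hP.strictConvexOn.2 (mem_Ici.2 (le_refl (0 : ℝ))) (mem_Ici.2 (zero_le_two (α := ℝ)))
    (by norm_num) (one_half_pos (α := ℝ)) (one_half_pos (α := ℝ)) (by norm_num)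
  simp only [smul_eq_mul, mul_zero, zero_add, hP.map_zero] at h
  norm_num at h
  linarith [hP.one_le_map_one]

theorem powerInv_nonneg (hP : IsPowerFunction P) {y : ℝ} (hy : 0 ≤ y) : 0 ≤ powerInv P y :=
  Function.invFunOn_mem (hP.bijOn.surjOn hy)

theorem map_powerInv (hP : IsPowerFunction P) {y : ℝ} (hy : 0 ≤ y) : P (powerInv P y) = y :=
  Function.invFunOn_eq (hP.bijOn.surjOn hy)

theorem powerInv_le (hP : IsPowerFunction P) {x y : ℝ} (hx : 0 ≤ x) (hxy : x ≤ y) :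
    powerInv P x ≤ powerInv P y := by
  have hy := hx.trans hxy
  rw [← hP.strictMonoOn.le_iff_le (hP.powerInv_nonneg hx) (hP.powerInv_nonneg hy),
    hP.map_powerInv hx, hP.map_powerInv hy]
  exact hxy

theorem powerInv_pos (hP : IsPowerFunction P) {y : ℝ} (hy : 0 < y) : 0 < powerInv P y := by
  rw [← hP.strictMonoOn.lt_iff_lt (mem_Ici.2 le_rfl) (hP.powerInv_nonneg hy.le),
    hP.map_powerInv hy.le, hP.map_zero]
  exact hy

/-- Convexity through the origin, read for the inverse. It makes `y / powerInv P y` nondecreasing,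
hence the weights for `m ≥ 2` monotone. -/
theorem powerInv_mul_le (hP : IsPowerFunction P) {κ y : ℝ} (hκ : 1 ≤ κ) (hy : 0 ≤ y) :
    powerInv P (κ * y) ≤ κ * powerInv P y := by
  have hκ0 : 0 ≤ κ := by linarith
  have h0 := hP.powerInv_nonneg hy
  rw [← hP.strictMonoOn.le_iff_le (hP.powerInv_nonneg (mul_nonneg hκ0 hy))
    (mul_nonneg hκ0 h0), hP.map_powerInv (mul_nonneg hκ0 hy)]
  calc κ * y = κ * P (powerInv P y) := by rw [hP.map_powerInv hy]
    _ ≤ _ := hP.mul_le_map_mul hκ h0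

theorem exists_subgradient (hP : IsPowerFunction P) {r : ℝ} (hr : 0 < r) :
    ∃ g : ℝ, ∀ s, 0 ≤ s → g * (s - r) ≤ P s - P r := by
  have hd : HasDerivAt P (deriv P r) r :=
    ((hP.differentiableOn r hr.le).differentiableAt (Ici_mem_nhds hr)).hasDerivAt
  refine ⟨deriv P r, fun s hs => ?_⟩
  have hc := hP.strictConvexOn.convexOn
  rcases lt_trichotomy s r with h | rfl | h
  · have h1 := hc.slope_le_of_hasDerivAt (mem_Ici.2 hs) (mem_Ici.2 hr.le) h hd
    rw [slope_def_field, div_le_iff₀ (by linarith)] at h1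
    linarith
  · simp
  · have h1 := hc.le_slope_of_hasDerivAt (mem_Ici.2 hr.le) (mem_Ici.2 hs) h hd
    rw [slope_def_field, le_div_iff₀ (by linarith)] at h1
    linarith

/-- With speed augmentation `ρ ≥ 3/2`, a chord of the power function is dominated by `P (ρ)`
times the power function, up to a constant. -/
theorem chord_le (hP : IsPowerFunction P) {ρ r s : ℝ} (hρ : 3 / 2 ≤ ρ) (hr : 0 < r)
    (hs : 0 ≤ s) : P ρ * (P r / r * s) ≤ P ρ * P s + (P ρ - 1) * P r := by
  set K := P ρ with hK
  have hρ0 : 0 < ρ := by linarith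
  have hKρ : 3 / 2 ≤ K := hρ.trans (hP.le_map (by linarith))
  have hK0 : 0 < K := by linarith
  have hPr := hP.pos hr
  have hPs := hP.nonneg hs
  obtain ⟨κ, rfl⟩ : ∃ κ, s = κ * r := ⟨s / r, by field_simp⟩
  have hκ : 0 ≤ κ := nonneg_of_mul_nonneg_left hs hr
  have e : P r / r * (κ * r) = κ * P r := by field_simp
  rw [e]
  have step : ∀ u, 0 < u → P (ρ * u) ≤ K * P u := fun u hu => hP.submultiplicative ρ u hρ0 hu
  have mono : ∀ u, r ≤ u → P r ≤ P u := fun u hu =>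
    hP.strictMonoOn.monotoneOn (mem_Ici.2 hr.le) (mem_Ici.2 (hr.le.trans hu)) hu
  have prod : ∀ a : ℝ, κ ≤ a → K * (κ * P r) ≤ K * a * P r := fun a ha => by
    have := mul_le_mul_of_nonneg_left (mul_le_mul_of_nonneg_right ha hPr.le) hK0.le
    linarith
  -- For `κ ≥ 1` convexity suffices. Otherwise the cases count how many factors `ρ` lift `κ * r` to
  -- at least `r`: each costs a factor `K` by submultiplicativity, while each one that does not
  -- suffice forces another factor `2 / 3` into the bound on `κ`.
  rcases le_or_gt 1 κ with h1 | h1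
  · have := hP.mul_le_map_mul h1 hr.le
    nlinarith [mul_le_mul_of_nonneg_left this hK0.le]
  rcases le_or_gt 1 (ρ * κ) with h2 | h2
  · have hκ0 : 0 < κ := pos_of_mul_pos_right (by linarith) hρ0.le
    have := mono (ρ * (κ * r)) (by nlinarith)
    have := step (κ * r) (by positivity)
    nlinarith [prod 1 h1.le]
  have b1 : κ ≤ 2 / 3 := by nlinarith
  have sq2 : ∀ a : ℝ, 0 ≤ a → 9 / 4 * a ≤ ρ * (ρ * a) := fun a ha => by
    rw [← mul_assoc ρ ρ a]
    exact mul_le_mul_of_nonneg_right (by nlinarith) ha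
  rcases le_or_gt 1 (ρ * (ρ * κ)) with h3 | h3
  · have hκ0 : 0 < κ := pos_of_mul_pos_right (pos_of_mul_pos_right (by linarith) hρ0.le) hρ0.le
    have q1 := mono (ρ * (ρ * (κ * r))) (by nlinarith)
    have q2 := step (ρ * (κ * r)) (by positivity)
    have q3 := step (κ * r) (by positivity)
    have q : P r ≤ K * (K * P (κ * r)) := by
      nlinarith [mul_le_mul_of_nonneg_left q3 hK0.le]
    -- The quadratic is `(K - 3 / 2) ^ 2 / 3 + 1 / 4`.
    have key : 0 ≤ (K * K / 3 + 1 - K) * P r := by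
      apply mul_nonneg _ hPr.le; nlinarith [sq_nonneg (K - 3 / 2)]
    have p := mul_le_mul_of_nonneg_left (prod _ b1) hK0.le
    nlinarith
  have b2 : κ ≤ 4 / 9 := by
    linarith [sq2 κ hκ]
  rcases le_or_gt 1 (ρ * (ρ * (ρ * κ))) with h4 | h4
  -- For `K ≥ 9 / 5` one has `4 / 9 * K ≤ K - 1`, so `P s` is not needed. For smaller `K`, two of
  -- the three factors `K` are bounded by `9 / 5`, whence `81 / 25`.
  · rcases le_or_gt (9 / 5) K with h5 | h5
    · nlinarith [prod _ b2, mul_nonneg hK0.le hPs, mul_le_mul_of_nonneg_right h5 hPr.le]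
    have hκ0 : 0 < κ := pos_of_mul_pos_right
      (pos_of_mul_pos_right (pos_of_mul_pos_right (by linarith) hρ0.le) hρ0.le) hρ0.le
    have q0 := mono (ρ * (ρ * (ρ * (κ * r)))) (by nlinarith)
    have q1 := step (ρ * (ρ * (κ * r))) (by positivity)
    have q2 := step (ρ * (κ * r)) (by positivity)
    have q3 := step (κ * r) (by positivity)
    have q4 : P (ρ * (κ * r)) ≤ 9 / 5 * P (κ * r) := by nlinarith
    have q5 : P (ρ * (ρ * (κ * r))) ≤ 81 / 25 * P (κ * r) := by
      have := hP.nonneg (s := ρ * (κ * r)) (by positivity)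
      nlinarith
    have q6 : P r ≤ K * (81 / 25 * P (κ * r)) := by
      nlinarith [mul_le_mul_of_nonneg_left q5 hK0.le]
    nlinarith [prod _ b2, mul_le_mul_of_nonneg_right hKρ hPr.le]
  -- Here `8 / 27 * K ≤ K - 1` already follows from `K ≥ 3 / 2`.
  · have b3 : κ ≤ 8 / 27 := by
      have := mul_le_mul_of_nonneg_right hρ hκ
      linarith [sq2 (ρ * κ) (by positivity)]
    nlinarith [prod _ b3, mul_nonneg hK0.le hPs, mul_le_mul_of_nonneg_right hKρ hPr.le]

end IsPowerFunction

/-! ### Weights with the required drift -/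

/-- The weights `g` of a potential `∑ g` under which `SRPT` has drift at most `C` times the cost
rate of any competitor, up to a multiple `σ` of the work done. Here `n` and `n'` are the numbers
of unfinished jobs of the two algorithms. -/
structure IsDriftWeight (P : ℝ → ℝ) (m : ℕ) (C σ : ℝ) (g : ℤ → ℝ) : Prop where
  monotone : Monotone g
  eq_zero : ∀ i ≤ 0, g i = 0
  drift : ∀ (n n' : ℕ) (j : ℤ), (j = n - n' ∨ 1 ≤ n' ∧ j = n - n' + 1) →
    ∃ μ : ℝ, (∀ s, 0 ≤ s → g j * s ≤ C * P s + μ) ∧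
      n - (min m n : ℕ) * speedRule P m n * (σ + g (j - (min m n : ℕ) + 1)) + m * μ ≤ C * n'

theorem IsDriftWeight.nonneg {P : ℝ → ℝ} {m : ℕ} {C σ : ℝ} {g : ℤ → ℝ}
    (hg : IsDriftWeight P m C σ g) (i : ℤ) : 0 ≤ g i := by
  rw [← hg.eq_zero (min i 0) (min_le_right _ _)]
  exact hg.monotone (min_le_left _ _)

theorem speedRule_pos {P : ℝ → ℝ} (hP : IsPowerFunction P) {m : ℕ} (hm : 1 ≤ m) (n : ℕ) :
    0 < speedRule P m n := by
  unfold speedRule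
  split_ifs with h
  · have h1 : (0 : ℝ) < n := by exact_mod_cast (show 0 < n by omega)
    have h2 : (0 : ℝ) < m := by exact_mod_cast (show 0 < m by omega)
    exact hP.powerInv_pos (by positivity)
  · exact hP.powerInv_pos one_pos

/-- The weight `g i` is the slope of `P` at speed `powerInv P i`, where the power is `i`. For one
busy server `j - 1 + 1 = j`, so both algorithms see the same weight and no `σ` is needed. This case
is separate because `chord_le` requires `ρ ≥ 3 / 2`, while `2 - 1 / m = 1`. -/
theorem exists_isDriftWeight_one {P : ℝ → ℝ} (hP : IsPowerFunction P) :
    ∃ g, IsDriftWeight P 1 1 0 g := by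
  have hsub : ∀ i : ℤ, ∃ c : ℝ, (i ≤ 0 → c = 0) ∧
      (0 < i → ∀ s, 0 ≤ s → c * (s - powerInv P i) ≤ P s - i) := fun i => by
    rcases le_or_gt i 0 with hi | hi
    · exact ⟨0, fun _ => rfl, fun h => absurd hi (not_le.2 h)⟩
    · have hi' : (0 : ℝ) < i := by exact_mod_cast hi
      obtain ⟨c, hc⟩ := hP.exists_subgradient (hP.powerInv_pos hi')
      rw [hP.map_powerInv hi'.le] at hc
      exact ⟨c, fun h => absurd h (not_le.2 hi), fun _ => hc⟩
  choose g hg0 hg using hsub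
  have hnonneg : ∀ i, 0 ≤ g i := fun i => by
    rcases le_or_gt i 0 with hi | hi
    · exact (hg0 i hi).ge
    · have hi' : (0 : ℝ) < i := by exact_mod_cast hi
      have h := hg i hi 0 le_rfl
      rw [hP.map_zero] at h
      have := hP.powerInv_pos hi'
      nlinarith
  have hmono : Monotone g := fun i k hik => by
    rcases le_or_gt i 0 with hi | hi
    · rw [hg0 i hi]; exact hnonneg k
    rcases hik.eq_or_lt with rfl | hlt
    · exact le_rfl
    have hi' : (0 : ℝ) < i := by exact_mod_cast hi
    have hlt' : (i : ℝ) < k := by exact_mod_cast hlt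
    have h1 := hg i hi (powerInv P k) (hP.powerInv_nonneg (hi'.trans hlt').le)
    have h2 := hg k (hi.trans hlt) (powerInv P i) (hP.powerInv_nonneg hi'.le)
    rw [hP.map_powerInv (hi'.trans hlt').le] at h1
    rw [hP.map_powerInv hi'.le] at h2
    have h3 : powerInv P i < powerInv P k := by
      refine lt_of_le_of_ne (hP.powerInv_le hi'.le hlt'.le) fun h => ?_
      have := congrArg P h
      rw [hP.map_powerInv hi'.le, hP.map_powerInv (hi'.trans hlt').le] at this
      exact hlt'.ne this
    by_contra hcon
    nlinarith [not_le.1 hcon]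
  refine ⟨g, hmono, fun i hi => hg0 i hi, fun n n' j hj => ?_⟩
  have hjn : (n : ℤ) - n' ≤ j := by omega
  have hjn' : (n : ℝ) - n' ≤ j := by exact_mod_cast hjn
  rcases le_or_gt j 0 with hj0 | hj0
  · have hj0' : (j : ℝ) ≤ 0 := by exact_mod_cast hj0
    refine ⟨0, fun s hs => ?_, ?_⟩
    · rw [hg0 j hj0]; simpa using hP.nonneg hs
    · have : 0 ≤ ((min 1 n : ℕ) : ℝ) * speedRule P 1 n * (0 + g (j - (min 1 n : ℕ) + 1)) := by
        have := (speedRule_pos hP le_rfl n).le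
        have := hnonneg (j - (min 1 n : ℕ) + 1)
        positivity
      simp only [mul_zero, add_zero, one_mul]
      linarith
  · have hn1 : 1 ≤ n := by omega
    have hj0' : (0 : ℝ) < j := by exact_mod_cast hj0
    have hjn : (j : ℝ) ≤ n := by
      have : j ≤ n := by omega
      exact_mod_cast this
    -- The tangent at `powerInv P j` determines `μ`. As `powerInv P j ≤ powerInv P n`, the terms
    -- with `g j` have nonpositive sum, leaving `n - j ≤ n'`.
    refine ⟨powerInv P j * g j - j, fun s hs => ?_, ?_⟩
    · linarith [hg j hj0 s hs]
    · have e : speedRule P 1 n = powerInv P n := by simp [speedRule, hn1]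
      rw [min_eq_left hn1, e]
      have := mul_le_mul_of_nonneg_right (hP.powerInv_le hj0'.le hjn) (hnonneg j)
      simp only [Nat.cast_one, one_mul, zero_add, sub_add_cancel]
      linarith

/-- With `φ y = y / powerInv P y`, the slope of the chord of `P` from the origin to height `y`, the
weight is `g i = K * φ ((i - 1)⁺ / m)`. SRPT at speed at least `powerInv P y` gains at least `y`
from `φ y`, and `chord_le` bounds what the competitor gains. -/
theorem exists_isDriftWeight_of_two_le {P : ℝ → ℝ} (hP : IsPowerFunction P) {m : ℕ}
    (hm : 2 ≤ m) : ∃ g, IsDriftWeight P m (P (2 - 1 / (m : ℝ)))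
      (P (2 - 1 / (m : ℝ)) / powerInv P 1) g := by
  have hm' : (2 : ℝ) ≤ m := by exact_mod_cast hm
  have hm0 : (0 : ℝ) < m := by linarith
  set ρ : ℝ := 2 - 1 / (m : ℝ) with hρdef
  have hρ : 3 / 2 ≤ ρ := by
    have : 1 / (m : ℝ) ≤ 1 / 2 := by gcongr
    linarith
  set K := P ρ with hK
  have hK1 : 1 ≤ K := by linarith [hP.le_map (show 1 ≤ ρ by linarith)]
  set s₁ := powerInv P 1 with hs₁
  have hs₁0 : 0 < s₁ := hP.powerInv_pos one_pos
  have hφmono : ∀ x y : ℝ, 0 ≤ x → x ≤ y → x / powerInv P x ≤ y / powerInv P y := by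
    intro x y hx hxy
    rcases hx.eq_or_lt with rfl | hx
    · rw [zero_div]; exact div_nonneg hxy (hP.powerInv_nonneg hxy)
    have hy := hx.trans_le hxy
    rw [div_le_div_iff₀ (hP.powerInv_pos hx) (hP.powerInv_pos hy)]
    have h := hP.powerInv_mul_le (κ := y / x) ((one_le_div hx).2 hxy) hx.le
    rw [div_mul_cancel₀ _ hx.ne'] at h
    calc x * powerInv P y ≤ x * (y / x * powerInv P x) := by gcongr
      _ = y * powerInv P x := by field_simp
  -- The shift by one makes the larger admissible index `j = n - n' + 1` carry the slope at `(n -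
  -- n')⁺ / m`.
  let g : ℤ → ℝ := fun i =>
    K * (max 0 (((i : ℝ) - 1) / m) / powerInv P (max 0 (((i : ℝ) - 1) / m)))
  have hmono : Monotone g := fun i k hik => by
    have : (i : ℝ) ≤ k := by exact_mod_cast hik
    exact mul_le_mul_of_nonneg_left (hφmono _ _ (le_max_left _ _) (by gcongr)) (by linarith)
  have hzero : ∀ i ≤ 1, g i = 0 := fun i hi => by
    have : (i : ℝ) ≤ 1 := by exact_mod_cast hi
    have : max 0 (((i : ℝ) - 1) / m) = 0 :=
      max_eq_left (div_nonpos_of_nonpos_of_nonneg (by linarith) hm0.le)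
    simp [g, this]
  refine ⟨g, hmono, fun i hi => hzero i (by omega), fun n n' j hj => ?_⟩
  have hg0 : ∀ i, 0 ≤ g i := fun i => by
    rw [← hzero (min i 1) (min_le_right _ _)]
    exact hmono (min_le_left _ _)
  have hsp := speedRule_pos hP (by omega : 1 ≤ m) n
  set x : ℝ := max 0 ((n : ℝ) - n') with hx
  have hx0 : 0 ≤ x := le_max_left _ _
  have hxm : max 0 (((n : ℝ) - n') / m) = x / m := by
    rw [hx, ← max_div_div_right hm0.le, zero_div]
  -- This is the error term of `chord_le` at `r = powerInv P (x / m)`; over `m` servers it adds up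
  -- to `(K - 1) * x`.
  refine ⟨(K - 1) * (x / m), fun s hs => ?_, ?_⟩
  · have hj' : g j ≤ g (n - n' + 1) := hmono (by omega)
    refine (mul_le_mul_of_nonneg_right hj' hs).trans ?_
    have e : g (n - n' + 1) = K * (x / m / powerInv P (x / m)) := by
      simp only [g]; push_cast; rw [add_sub_cancel_right, hxm]
    rw [e]
    rcases hx0.eq_or_lt with h | h
    · rw [← h]
      simpa using mul_nonneg (by linarith) (hP.nonneg hs)
    · have hr := hP.powerInv_pos (y := x / m) (by positivity)
      have := hP.chord_le hρ hr hs
      rw [hP.map_powerInv (by positivity)] at this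
      linarith
  · have e1 : (m : ℝ) * ((K - 1) * (x / m)) = (K - 1) * x := by field_simp
    rw [e1]
    have hn'0 : (0 : ℝ) ≤ n' := Nat.cast_nonneg _
    have hn0 : (0 : ℝ) ≤ n := Nat.cast_nonneg _
    have hxn : x ≤ n := max_le hn0 (by linarith)
    have hgj : g (n - n' - (min m n : ℕ) + 1) ≤ g (j - (min m n : ℕ) + 1) := hmono (by omega)
    rcases le_or_gt m n with hmn | hmn
    · have hmn' : (m : ℝ) ≤ n := by exact_mod_cast hmn
      rw [min_eq_left hmn] at hgj ⊢
      have es : speedRule P m n = powerInv P (n / m) := by simp [speedRule, hmn]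
      rw [es] at hsp ⊢
      have hs1 : s₁ ≤ powerInv P (n / m) :=
        hP.powerInv_le zero_le_one ((one_le_div hm0).2 hmn')
      -- All servers run at speed at least `s₁`, so the `σ` term yields at least `m * K`, exactly
      -- the loss from shifting the index by `m`.
      have h1 : K ≤ powerInv P (n / m) * (K / s₁) := by
        rw [mul_div_assoc', le_div_iff₀ hs₁0, mul_comm]
        gcongr
      have h1' : m * K ≤ m * powerInv P (n / m) * (K / s₁) := by
        have := mul_le_mul_of_nonneg_left h1 hm0.le
        linarith
      rcases le_or_gt (m : ℝ) ((n : ℝ) - n') with hxm2 | hxm2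
      · have ex : x = n - n' := max_eq_right (by linarith)
        have e : g (n - n' - m + 1) =
            K * ((n - n' - m) / m / powerInv P ((n - n' - m) / m)) := by
          simp only [g]; push_cast
          rw [add_sub_cancel_right, max_eq_right (div_nonneg (by linarith) hm0.le)]
        -- With `y = (n - n' - m) / m ≤ n / m`, this is `φ y * powerInv P (n / m) ≥ φ y * powerInv P
        -- y = y`.
        have h2 : K * (n - n' - m) ≤ m * powerInv P (n / m) * g (n - n' - m + 1) := by
          rw [e]
          rcases (show (m : ℝ) ≤ n - n' from hxm2).eq_or_lt with h | h
          · simp [← h]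
          have hy : 0 < ((n : ℝ) - n' - m) / m := div_pos (by linarith) hm0
          have hp := hP.powerInv_pos hy
          have hle := hP.powerInv_le hy.le (show ((n : ℝ) - n' - m) / m ≤ n / m by
            gcongr; linarith)
          have e3 : K * ((n : ℝ) - n' - m) = m * powerInv P ((n - n' - m) / m) *
              (K * ((n - n' - m) / m / powerInv P ((n - n' - m) / m))) := by
            field_simp
          rw [e3]
          gcongr
        have h3 := mul_le_mul_of_nonneg_left hgj (mul_pos hm0 hsp).le
        have h4 := mul_le_mul_of_nonneg_right hK1 hn'0
        rw [mul_add, ex]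
        nlinarith
      · have h3 : 0 ≤ m * powerInv P (n / m) * g (j - m + 1) :=
          mul_nonneg (mul_pos hm0 hsp).le (hg0 _)
        rw [mul_add]
        rcases max_cases 0 ((n : ℝ) - n') with ⟨h, h'⟩ | ⟨h, h'⟩
        · rw [← hx] at h
          rw [h]; nlinarith
        · rw [← hx] at h
          rw [h]; nlinarith
    -- With idle servers the `σ` term is exactly `n * K`, which covers `n + (K - 1) * x` on its own
    -- since `x ≤ n`.
    · rw [min_eq_right hmn.le] at hgj ⊢
      have es : speedRule P m n = s₁ := by simp [speedRule, not_le.2 hmn, hs₁]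
      rw [es]
      have e2 : (n : ℝ) * s₁ * (K / s₁) = n * K := by field_simp
      rw [mul_add, e2]
      have h3 : 0 ≤ n * s₁ * g (j - n + 1) := mul_nonneg (by positivity) (hg0 _)
      nlinarith [mul_le_mul_of_nonneg_left hxn (show 0 ≤ K - 1 by linarith),
        mul_nonneg (show 0 ≤ K by linarith) hn'0]

/-- Of the factor `max 1 (P (sBar P))` in the ratio only the bound `≥ 1` is needed. -/
theorem exists_isDriftWeight {P : ℝ → ℝ} (hP : IsPowerFunction P) {m : ℕ} (hm : 1 ≤ m) :
    ∃ C σ g, 0 < C ∧ 0 ≤ σ ∧ 2 * (C + σ) ≤ srptRatio P m ∧ IsDriftWeight P m C σ g := by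
  have hs := hP.powerInv_pos one_pos
  have hK : 1 ≤ P (2 - 1 / (m : ℝ)) := by
    have : 1 / (m : ℝ) ≤ 1 := by
      rw [div_le_one (by exact_mod_cast hm)]; exact_mod_cast hm
    have h1 : 1 ≤ 2 - 1 / (m : ℝ) := by linarith
    linarith [hP.le_map h1]
  have hmain : P (2 - 1 / (m : ℝ)) * (2 + 2 / powerInv P 1) ≤ srptRatio P m := by
    unfold srptRatio
    have : 2 / powerInv P 1 * 1 ≤ 2 / powerInv P 1 * max 1 (P (sBar P)) := by
      gcongr; exact le_max_left _ _
    gcongr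
    linarith
  rcases hm.eq_or_lt with rfl | hm
  · obtain ⟨g, hg⟩ := exists_isDriftWeight_one hP
    refine ⟨1, 0, g, one_pos, le_rfl, hmain.trans' ?_, hg⟩
    have : 0 < 2 / powerInv P 1 := by positivity
    nlinarith
  · obtain ⟨g, hg⟩ := exists_isDriftWeight_of_two_le hP hm
    refine ⟨_, _, g, by linarith, by positivity, hmain.trans' (le_of_eq ?_), hg⟩
    ring

/-! ### The discrete primitive of the weight -/

/-- The sum `g 1 + ⋯ + g i`, which is `0` for `i ≤ 0`. -/
noncomputable def cumWeight (g : ℤ → ℝ) (i : ℤ) : ℝ := ∑ k ∈ Finset.range i.toNat, g (k + 1)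

section CumWeight

variable {g : ℤ → ℝ}

theorem cumWeight_add_one (h0 : ∀ i ≤ 0, g i = 0) (i : ℤ) :
    cumWeight g (i + 1) = cumWeight g i + g (i + 1) := by
  unfold cumWeight
  rcases le_or_gt 0 i with hi | hi
  · obtain ⟨k, rfl⟩ := Int.eq_ofNat_of_zero_le hi
    rw [show ((k : ℤ) + 1).toNat = k + 1 by omega, Int.toNat_natCast, Finset.sum_range_succ]
  · rw [h0 (i + 1) (by omega), show (i + 1).toNat = 0 by omega, show i.toNat = 0 by omega]
    simp

theorem le_cumWeight_sub (hg : Monotone g) (h0 : ∀ i ≤ 0, g i = 0) {p q : ℤ} (hpq : p ≤ q) :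
    (q - p) * g (p + 1) ≤ cumWeight g q - cumWeight g p := by
  induction q, hpq using Int.leInduction with
  | base => simp
  | succ k hk ih =>
    rw [cumWeight_add_one h0]
    have := hg (show p + 1 ≤ k + 1 by omega)
    push_cast
    linarith

theorem cumWeight_sub_le (hg : Monotone g) (h0 : ∀ i ≤ 0, g i = 0) {p q : ℤ} (hpq : p ≤ q) :
    cumWeight g q - cumWeight g p ≤ (q - p) * g q := by
  induction q, hpq using Int.leInduction with
  | base => simp
  | succ k hk ih =>
    rw [cumWeight_add_one h0]
    have := hg (show k ≤ k + 1 by omega)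
    have hk' : (p : ℝ) ≤ k := by exact_mod_cast hk
    push_cast
    nlinarith

theorem cumWeight_nonneg (hg : Monotone g) (h0 : ∀ i ≤ 0, g i = 0) (i : ℤ) :
    0 ≤ cumWeight g i := by
  refine Finset.sum_nonneg fun k _ => ?_
  rw [← h0 0 le_rfl]
  exact hg (by omega)

theorem cumWeight_mono (hg : Monotone g) (h0 : ∀ i ≤ 0, g i = 0) : Monotone (cumWeight g) := by
  intro p q hpq
  have h1 := le_cumWeight_sub hg h0 hpq
  have h2 : 0 ≤ g (p + 1) := by
    rcases le_total (p + 1) 0 with h | h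
    · rw [h0 _ h]
    · rw [← h0 0 le_rfl]; exact hg h
  have h3 : (p : ℝ) ≤ q := by exact_mod_cast hpq
  nlinarith

/-- This is the effect of a move at a single level `q`. In the first alternative the SRPT count
moves before the virtual one, in the second after it. The order decides which intermediate
difference appears, and monotonicity of `g` bounds the weights on either leg by `g (j - a + 1)` and
`g j`. -/
theorem cumWeight_move_le (hg : Monotone g) (h0 : ∀ i ≤ 0, g i = 0) {N N' M M' n n' a j : ℤ}
    (hN : N' ≤ N) (hM : M' ≤ M) (hA : N' < N → n - a ≤ N') (hMn : M ≤ n') (hNn : N ≤ n)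
    (hB : M' < M → M = n' ∧ M' = n' - 1)
    (hj : (j = n - n' ∧ (M' < M → N' ≤ n - 1)) ∨ (j = n - n' + 1 ∧ (N' < N → M' ≤ n' - 1))) :
    cumWeight g (N' - M') ≤
      cumWeight g (N - M) - (N - N') * g (j - a + 1) + (M - M') * g j := by
  have hNr : (0 : ℝ) ≤ N - N' := by rw [sub_nonneg]; exact_mod_cast hN
  have hMr : (0 : ℝ) ≤ M - M' := by rw [sub_nonneg]; exact_mod_cast hM
  rcases hj with ⟨rfl, hj⟩ | ⟨rfl, hj⟩
  · have h1 := le_cumWeight_sub hg h0 (show N' - M ≤ N - M by omega)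
    have h2 := cumWeight_sub_le hg h0 (show N' - M ≤ N' - M' by omega)
    push_cast at h1 h2
    have h3 : ((N : ℝ) - N') * g (n - n' - a + 1) ≤ (N - N') * g (N' - M + 1) := by
      rcases hN.eq_or_lt with rfl | h
      · simp
      · exact mul_le_mul_of_nonneg_left (hg (by have := hA h; omega)) hNr
    have h4 : ((M : ℝ) - M') * g (N' - M') ≤ (M - M') * g (n - n') := by
      rcases hM.eq_or_lt with rfl | h
      · simp
      · exact mul_le_mul_of_nonneg_left (hg (by have := hj h; have := hB h; omega)) hMr
    linarith
  · have h1 := le_cumWeight_sub hg h0 (show N' - M' ≤ N - M' by omega)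
    have h2 := cumWeight_sub_le hg h0 (show N - M ≤ N - M' by omega)
    push_cast at h1 h2
    have h3 : ((N : ℝ) - N') * g (n - n' + 1 - a + 1) ≤ (N - N') * g (N' - M' + 1) := by
      rcases hN.eq_or_lt with rfl | h
      · simp
      · exact mul_le_mul_of_nonneg_left (hg (by have := hA h; have := hj h; omega)) hNr
    have h4 : ((M : ℝ) - M') * g (N - M') ≤ (M - M') * g (n - n' + 1) := by
      rcases hM.eq_or_lt with rfl | h
      · simp
      · exact mul_le_mul_of_nonneg_left (hg (by have := hB h; omega)) hMr
    linarith

end CumWeight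

/-! ### The potential and its change under a move -/

section Potential

variable {ι : Type*}

/-- The number of indices in `R` with value above `q`. -/
noncomputable def countAbove (R : Finset ι) (x : ι → ℝ) (q : ℝ) : ℕ :=
  (R.filter fun j => q < x j).card

theorem countAbove_antitone (R : Finset ι) (x : ι → ℝ) : Antitone (countAbove R x) :=
  fun _ _ h => Finset.card_le_card
    (Finset.monotone_filter_right R fun _ _ hj => h.trans_lt hj)

theorem countAbove_mono {R : Finset ι} {x x' : ι → ℝ} (h : ∀ j ∈ R, x j ≤ x' j) (q : ℝ) :
    countAbove R x q ≤ countAbove R x' q :=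
  Finset.card_le_card fun j hj => by
    rw [Finset.mem_filter] at hj ⊢
    exact ⟨hj.1, hj.2.trans_le (h j hj.1)⟩

theorem measurable_countAbove (R : Finset ι) (x : ι → ℝ) : Measurable (countAbove R x) :=
  (countAbove_antitone R x).measurable

theorem integrableOn_countAbove (R : Finset ι) (x : ι → ℝ) (T : ℝ) :
    IntegrableOn (fun q => (countAbove R x q : ℝ)) (Ico 0 T) := by
  refine Measure.integrableOn_of_bounded (M := R.card) (by simp)
    (measurable_from_nat.comp (measurable_countAbove R x)).aestronglyMeasurable
    (Filter.Eventually.of_forall fun q => ?_)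
  rw [Real.norm_of_nonneg (Nat.cast_nonneg _)]
  exact_mod_cast Finset.card_filter_le _ _

/-- The layer-cake formula; it turns changes of level counts into amounts of work. -/
theorem integral_countAbove {R : Finset ι} {x : ι → ℝ} {T : ℝ} (h0 : ∀ j ∈ R, 0 ≤ x j)
    (hT : ∀ j ∈ R, x j ≤ T) : ∫ q in Ico 0 T, (countAbove R x q : ℝ) = ∑ j ∈ R, x j := by
  have e : ∀ q, (countAbove R x q : ℝ) = ∑ j ∈ R, (Iio (x j)).indicator (fun _ => (1 : ℝ)) q := by
    intro q
    simp [countAbove, indicator_apply]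
  simp_rw [e]
  rw [integral_finsetSum]
  · refine Finset.sum_congr rfl fun j hj => ?_
    rw [integral_indicator measurableSet_Iio, Measure.restrict_restrict measurableSet_Iio]
    have : Iio (x j) ∩ Ico 0 T = Ico 0 (x j) := by
      ext q; simp only [mem_inter_iff, mem_Iio, mem_Ico]
      constructor
      · rintro ⟨h1, h2, -⟩; exact ⟨h2, h1⟩
      · rintro ⟨h1, h2⟩; exact ⟨h2, h1, h2.trans_le (hT j hj)⟩
    simp [this, h0 j hj]
  · intro j _
    exact (integrable_const (1 : ℝ)).indicator measurableSet_Iio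

/-- The potential of the states `x` and `z` of two algorithms with the same released jobs `R`. -/
noncomputable def potential (g : ℤ → ℝ) (T : ℝ) (R : Finset ι) (x z : ι → ℝ) : ℝ :=
  ∫ q in Ico 0 T, cumWeight g (countAbove R x q - countAbove R z q)

variable {g : ℤ → ℝ}

theorem integrableOn_cumWeight (hg : Monotone g) (h0 : ∀ i ≤ 0, g i = 0) (T : ℝ) (R : Finset ι)
    (x z : ι → ℝ) :
    IntegrableOn (fun q => cumWeight g (countAbove R x q - countAbove R z q)) (Ico 0 T) := by
  refine Measure.integrableOn_of_bounded (M := cumWeight g R.card) (by simp) ?_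
    (Filter.Eventually.of_forall fun q => ?_)
  · exact ((measurable_of_countable fun p : ℕ × ℕ => cumWeight g (p.1 - p.2)).comp
      ((measurable_countAbove R x).prodMk (measurable_countAbove R z))).aestronglyMeasurable
  · rw [Real.norm_of_nonneg (cumWeight_nonneg hg h0 _)]
    have : countAbove R x q ≤ R.card := Finset.card_filter_le _ _
    exact cumWeight_mono hg h0 (by omega)

theorem potential_nonneg (hg : Monotone g) (h0 : ∀ i ≤ 0, g i = 0) (T : ℝ) (R : Finset ι)
    (x z : ι → ℝ) : 0 ≤ potential g T R x z :=
  integral_nonneg fun _ => cumWeight_nonneg hg h0 _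

theorem potential_congr {T : ℝ} {R : Finset ι} {x x' z z' : ι → ℝ} (hx : ∀ j ∈ R, x j = x' j)
    (hz : ∀ j ∈ R, z j = z' j) : potential g T R x z = potential g T R x' z' := by
  have e : ∀ {u v : ι → ℝ} (_ : ∀ j ∈ R, u j = v j) q, countAbove R u q = countAbove R v q :=
    fun h q => by
      unfold countAbove
      rw [Finset.filter_congr fun j hj => by rw [h j hj]]
  unfold potential
  simp_rw [e hx, e hz]

/-- Arrivals do not change the potential: a new job enters both counts at the same levels and
cancels in the difference. -/
theorem potential_eq_of_subset [DecidableEq ι] {T : ℝ} {R R' : Finset ι} {x z : ι → ℝ}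
    (hR : R ⊆ R') (h : ∀ j ∈ R' \ R, x j = z j) : potential g T R' x z = potential g T R x z := by
  unfold potential
  congr 1
  ext q
  have e : ∀ u : ι → ℝ, countAbove R' u q = countAbove R u q + countAbove (R' \ R) u q := fun u => by
    unfold countAbove
    rw [← Finset.card_union_of_disjoint
      (Finset.disjoint_filter_filter Finset.disjoint_sdiff),
      ← Finset.filter_union, Finset.union_sdiff_of_subset hR]
  have e' : countAbove (R' \ R) x q = countAbove (R' \ R) z q := by
    unfold countAbove
    rw [Finset.filter_congr fun j hj => by rw [h j hj]]
  rw [e x, e z, e']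
  congr 1
  push_cast
  ring

theorem potential_move_le_of_forall (hg : Monotone g) (h0 : ∀ i ≤ 0, g i = 0) {T : ℝ}
    {R : Finset ι} {x x' z z' : ι → ℝ} {G G' : ℝ}
    (hx : ∀ j ∈ R, 0 ≤ x j ∧ x j ≤ T) (hx' : ∀ j ∈ R, 0 ≤ x' j ∧ x' j ≤ T)
    (hz : ∀ j ∈ R, 0 ≤ z j ∧ z j ≤ T) (hz' : ∀ j ∈ R, 0 ≤ z' j ∧ z' j ≤ T)
    (h : ∀ q, 0 ≤ q → cumWeight g (countAbove R x' q - countAbove R z' q) ≤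
      cumWeight g (countAbove R x q - countAbove R z q) -
        (countAbove R x q - countAbove R x' q) * G + (countAbove R z q - countAbove R z' q) * G') :
    potential g T R x' z' ≤ potential g T R x z - (∑ j ∈ R, x j - ∑ j ∈ R, x' j) * G +
      (∑ j ∈ R, z j - ∑ j ∈ R, z' j) * G' := by
  rw [← integral_countAbove (fun j hj => (hx j hj).1) (fun j hj => (hx j hj).2),
    ← integral_countAbove (fun j hj => (hx' j hj).1) (fun j hj => (hx' j hj).2),
    ← integral_countAbove (fun j hj => (hz j hj).1) (fun j hj => (hz j hj).2),
    ← integral_countAbove (fun j hj => (hz' j hj).1) (fun j hj => (hz' j hj).2)]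
  have i1 := integrableOn_countAbove R x T
  have i2 := integrableOn_countAbove R x' T
  have i3 := integrableOn_countAbove R z T
  have i4 := integrableOn_countAbove R z' T
  have j1 : IntegrableOn (fun q => ((countAbove R x q : ℝ) - countAbove R x' q) * G) (Ico 0 T) :=
    (i1.sub i2).mul_const G
  have j2 : IntegrableOn (fun q => ((countAbove R z q : ℝ) - countAbove R z' q) * G') (Ico 0 T) :=
    (i3.sub i4).mul_const G'
  have k1 := integrableOn_cumWeight hg h0 T R x z
  unfold potential
  rw [← integral_sub i1 i2, ← integral_sub i3 i4, ← integral_mul_const, ← integral_mul_const,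
    ← integral_sub k1 j1]
  have e := integral_add (k1.sub j1) j2
  simp only [Pi.sub_apply] at e
  rw [← e]
  exact setIntegral_mono_on (integrableOn_cumWeight hg h0 T R x' z') ((k1.sub j1).add j2)
    measurableSet_Ico fun q hq => h q hq.1

variable [DecidableEq ι]

/-- Effect on the potential of decreasing the smallest positive values of `x` by `d`, and the
smallest positive value of `z` by `e`. -/
theorem exists_potential_move_le (hg : Monotone g) (h0 : ∀ i ≤ 0, g i = 0) {T : ℝ}
    {R A : Finset ι} {x z z' : ι → ℝ} {d : ℝ}
    (hx : ∀ j ∈ R, 0 ≤ x j ∧ x j ≤ T) (hz : ∀ j ∈ R, 0 ≤ z j ∧ z j ≤ T)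
    (hAR : A ⊆ R) (hd : 0 ≤ d) (hdA : ∀ j ∈ A, d ≤ x j) (hA0 : ∀ j ∈ A, 0 < x j)
    (hA : ∀ i ∈ A, ∀ j ∈ R, j ∉ A → 0 < x j → x i ≤ x j)
    (hz' : z' = z ∨ ∃ p ∈ R, ∃ e, 0 < z p ∧ (∀ j ∈ R, 0 < z j → z p ≤ z j) ∧ 0 ≤ e ∧ e ≤ z p ∧
      z' = Function.update z p (z p - e)) :
    ∃ j : ℤ, (j = countAbove R x 0 - countAbove R z 0 ∨
        1 ≤ countAbove R z 0 ∧ j = countAbove R x 0 - countAbove R z 0 + 1) ∧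
      potential g T R (fun i => if i ∈ A then x i - d else x i) z' ≤
        potential g T R x z - A.card * d * g (j - A.card + 1) +
          (∑ j ∈ R, z j - ∑ j ∈ R, z' j) * g j := by
  set x' : ι → ℝ := fun i => if i ∈ A then x i - d else x i with hx'def
  have hxx' : ∀ j, x' j ≤ x j := fun j => by simp only [hx'def]; split_ifs <;> linarith
  have hx' : ∀ j ∈ R, 0 ≤ x' j ∧ x' j ≤ T := fun j hj =>
    ⟨by
      simp only [hx'def]; split_ifs with h
      · linarith [hdA j h]
      · exact (hx j hj).1, (hxx' j).trans (hx j hj).2⟩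
  have hzz' : ∀ j ∈ R, 0 ≤ z' j ∧ z' j ≤ z j := fun j hj => by
    rcases hz' with rfl | ⟨p, -, e, -, -, he0, he, rfl⟩
    · exact ⟨(hz j hj).1, le_rfl⟩
    · by_cases hjp : j = p
      · subst hjp; simp only [Function.update_self]; constructor <;> linarith
      · rw [Function.update_of_ne hjp]; exact ⟨(hz j hj).1, le_rfl⟩
  have hsum : ∑ j ∈ R, x j - ∑ j ∈ R, x' j = A.card * d := by
    have e : ∀ i, x i - x' i = if i ∈ A then d else 0 := fun i => by
      simp only [hx'def]; split_ifs <;> ring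
    rw [← Finset.sum_sub_distrib]
    simp_rw [e]
    rw [Finset.sum_ite_mem, Finset.inter_eq_right.2 hAR, Finset.sum_const, nsmul_eq_mul]
  set n := countAbove R x 0 with hn
  set n' := countAbove R z 0 with hn'
  have hNn : ∀ q, 0 ≤ q → countAbove R x q ≤ n := fun q hq => countAbove_antitone R x hq
  have hMn : ∀ q, 0 ≤ q → countAbove R z q ≤ n' := fun q hq => countAbove_antitone R z hq
  have hN : ∀ q, countAbove R x' q ≤ countAbove R x q := countAbove_mono fun j _ => hxx' j
  have hM : ∀ q, countAbove R z' q ≤ countAbove R z q := countAbove_mono fun j hj => (hzz' j hj).2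
  have hlow : ∀ q, 0 ≤ q → countAbove R x' q < countAbove R x q →
      ∃ i ∈ A, x i - d ≤ q ∧ q < x i := fun q _ hlt => by
    by_contra hcon
    push Not at hcon
    refine hlt.not_ge (Finset.card_le_card fun j hj => ?_)
    rw [Finset.mem_filter] at hj ⊢
    refine ⟨hj.1, ?_⟩
    simp only [hx'def]
    split_ifs with h
    · by_contra h'
      exact absurd hj.2 (not_lt.2 (hcon j h (not_lt.1 h')))
    · exact hj.2
  -- If some served job crosses level `q`, then every unserved positive job is at least as large as
  -- that job was, hence stays above `q`. At most `A.card` of the `n` jobs are therefore not above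
  -- `q`.
  have hNA : ∀ q, 0 ≤ q → countAbove R x' q < countAbove R x q →
      (n : ℤ) - A.card ≤ countAbove R x' q := fun q hq hlt => by
    obtain ⟨i, hi, -, hiq⟩ := hlow q hq hlt
    have h1 : (R.filter fun j => 0 < x j) \ A ⊆ R.filter fun j => q < x' j := fun j hj => by
      simp only [Finset.mem_sdiff, Finset.mem_filter] at hj
      rw [Finset.mem_filter]
      refine ⟨hj.1.1, ?_⟩
      simp only [hx'def, hj.2, if_false]
      exact hiq.trans_le (hA i hi j hj.1.1 hj.2 hj.1.2)
    have h2 := Finset.card_le_card h1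
    have h3 := Finset.le_card_sdiff A (R.filter fun j => 0 < x j)
    have h4 : n = (R.filter fun j => 0 < x j).card := rfl
    have h5 : countAbove R x' q = (R.filter fun j => q < x' j).card := rfl
    omega
  have finish : ∀ j : ℤ, (∀ q, 0 ≤ q → countAbove R z' q < countAbove R z q →
        (countAbove R z q : ℤ) = n' ∧ (countAbove R z' q : ℤ) = n' - 1) →
      (∀ q, 0 ≤ q → (j = n - n' ∧ (countAbove R z' q < countAbove R z q →
          (countAbove R x' q : ℤ) ≤ n - 1)) ∨
        (j = n - n' + 1 ∧ (countAbove R x' q < countAbove R x q →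
          (countAbove R z' q : ℤ) ≤ n' - 1))) →
      potential g T R x' z' ≤ potential g T R x z - A.card * d * g (j - A.card + 1) +
          (∑ j ∈ R, z j - ∑ j ∈ R, z' j) * g j := fun j hB hj => by
    rw [← hsum]
    refine potential_move_le_of_forall hg h0 hx hx' hz
      (fun j hj => ⟨(hzz' j hj).1, (hzz' j hj).2.trans (hz j hj).2⟩) fun q hq => ?_
    have := cumWeight_move_le hg h0 (N := countAbove R x q) (N' := countAbove R x' q)
      (M := countAbove R z q) (M' := countAbove R z' q) (n := n) (n' := n') (a := A.card) (j := j)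
      (by exact_mod_cast hN q) (by exact_mod_cast hM q)
      (fun h => hNA q hq (by exact_mod_cast h)) (by exact_mod_cast hMn q hq)
      (by exact_mod_cast hNn q hq) (fun h => hB q hq (by exact_mod_cast h))
      (by simpa only [Nat.cast_lt] using hj q hq)
    simpa only [Int.cast_natCast] using this
  rcases hz' with rfl | ⟨p, hpR, e, hp0, hpmin, he0, he, rfl⟩
  · refine ⟨n - n', Or.inl rfl, finish _ (fun q _ h => absurd h (lt_irrefl _)) fun q _ =>
      Or.inl ⟨rfl, fun h => absurd h (lt_irrefl _)⟩⟩
  set z' := Function.update z p (z p - e) with hz'def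
  have hn'1 : 1 ≤ n' := Finset.card_pos.2 ⟨p, Finset.mem_filter.2 ⟨hpR, hp0⟩⟩
  have hzp : ∀ q, q < z p → 0 ≤ q → countAbove R z q = n' := fun q hq hq0 => by
    refine le_antisymm (hMn q hq0) (Finset.card_le_card fun j hj => ?_)
    rw [Finset.mem_filter] at hj ⊢
    exact ⟨hj.1, hq.trans_le (hpmin j hj.1 hj.2)⟩
  have hz'p : ∀ q, z p - e ≤ q → 0 ≤ q → countAbove R z' q ≤ n' - 1 := fun q hq hq0 => by
    have : (R.filter fun j => q < z' j) ⊆ (R.filter fun j => 0 < z j).erase p := fun j hj => by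
      rw [Finset.mem_filter] at hj
      by_cases hjp : j = p
      · rw [hjp, hz'def, Function.update_self] at hj
        exact absurd hj.2 (not_lt.2 hq)
      · rw [hz'def, Function.update_of_ne hjp] at hj
        exact Finset.mem_erase.2 ⟨hjp, Finset.mem_filter.2 ⟨hj.1, hq0.trans_lt hj.2⟩⟩
    have h := Finset.card_le_card this
    rwa [Finset.card_erase_of_mem (Finset.mem_filter.2 ⟨hpR, hp0⟩)] at h
  have hwin : ∀ q, countAbove R z' q < countAbove R z q → z p - e ≤ q ∧ q < z p := fun q h => by
    by_contra hcon
    refine h.not_ge (Finset.card_le_card fun j hj => ?_)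
    rw [Finset.mem_filter] at hj ⊢
    refine ⟨hj.1, ?_⟩
    by_cases hjp : j = p
    · rw [hjp] at hj ⊢
      rw [hz'def, Function.update_self]
      by_contra h'
      exact hcon ⟨not_lt.1 h', hj.2⟩
    · rw [hz'def, Function.update_of_ne hjp]; exact hj.2
  -- The virtual count changes only for `q ∈ [z p - e, z p)`. There all `n'` positive entries were
  -- above `q`, `z p` being the smallest, and exactly one drops out.
  have hB : ∀ q, 0 ≤ q → countAbove R z' q < countAbove R z q →
      (countAbove R z q : ℤ) = n' ∧ (countAbove R z' q : ℤ) = n' - 1 := fun q hq h => by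
    obtain ⟨h1, h2⟩ := hwin q h
    have h3 := hzp q h2 hq
    have h5 : countAbove R z q ≤ countAbove R z' q + 1 := by
      have hsub : (R.filter fun j => q < z j) ⊆ insert p (R.filter fun j => q < z' j) := by
        intro j hj
        rw [Finset.mem_filter] at hj
        by_cases hjp : j = p
        · rw [hjp]; exact Finset.mem_insert_self _ _
        · refine Finset.mem_insert_of_mem (Finset.mem_filter.2 ⟨hj.1, ?_⟩)
          rw [hz'def, Function.update_of_ne hjp]; exact hj.2
      exact (Finset.card_le_card hsub).trans (Finset.card_insert_le _ _)
    omega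
  -- This comparison of final positions fixes `j` uniformly in `q`. If a served job ends at or below
  -- the drained virtual job, SRPT has lost a job wherever the virtual count drops; otherwise the
  -- virtual state has lost one wherever the SRPT count drops.
  by_cases hcase : ∃ i ∈ A, x i - d ≤ z p - e
  · obtain ⟨i, hi, hie⟩ := hcase
    refine ⟨n - n', Or.inl rfl, finish _ hB fun q hq => Or.inl ⟨rfl, fun h => ?_⟩⟩
    have hiq := hie.trans (hwin q h).1
    have hsub : (R.filter fun j => q < x' j) ⊆ (R.filter fun j => 0 < x j).erase i := by
      intro j hj
      rw [Finset.mem_filter] at hj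
      refine Finset.mem_erase.2 ⟨?_, Finset.mem_filter.2
        ⟨hj.1, (hq.trans_lt hj.2).trans_le (hxx' j)⟩⟩
      rintro rfl
      have h := hj.2
      simp only [hx'def, hi, if_true] at h
      exact absurd h (not_lt.2 hiq)
    have h' := Finset.card_le_card hsub
    have hmem : i ∈ R.filter fun j => 0 < x j := Finset.mem_filter.2 ⟨hAR hi, hA0 i hi⟩
    rw [Finset.card_erase_of_mem hmem] at h'
    have h1 : 1 ≤ n := Finset.card_pos.2 ⟨i, hmem⟩
    have h4 : n = (R.filter fun j => 0 < x j).card := rfl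
    have h5 : countAbove R x' q = (R.filter fun j => q < x' j).card := rfl
    omega
  · push Not at hcase
    refine ⟨n - n' + 1, Or.inr ⟨hn'1, rfl⟩, finish _ hB fun q hq => Or.inr ⟨rfl, fun h => ?_⟩⟩
    obtain ⟨i, hi, hiq, -⟩ := hlow q hq h
    have := hz'p q ((hcase i hi).le.trans hiq) hq
    omega

end Potential

/-! ### Dominance of the single fast server -/

section Dominance

variable {ι : Type*} [DecidableEq ι]

/-- For every `k`, the sum of all but the `k` largest values of `z` is at most that of `y`. -/
def Dominates (R : Finset ι) (z y : ι → ℝ) : Prop :=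
  ∀ B ⊆ R, ∃ B' ⊆ R, B'.card ≤ B.card ∧ ∑ j ∈ R \ B', z j ≤ ∑ j ∈ R \ B, y j

variable {R R' : Finset ι} {z y z' y' : ι → ℝ}

/-- Remove the positive entries of `y`: the rest sums to `0`, so the no larger matching set `B'`
must contain every positive entry of `z`. -/
theorem Dominates.countAbove_le (h : Dominates R z y) (hz : ∀ j ∈ R, 0 ≤ z j)
    (hy : ∀ j ∈ R, 0 ≤ y j) : countAbove R z 0 ≤ countAbove R y 0 := by
  obtain ⟨B', -, hcard, hsum⟩ := h (R.filter fun j => 0 < y j) (Finset.filter_subset _ _)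
  have hzero : ∑ j ∈ R \ R.filter fun j => 0 < y j, y j = 0 :=
    Finset.sum_eq_zero fun j hj => by
      simp only [Finset.mem_sdiff, Finset.mem_filter, not_and, not_lt] at hj
      exact le_antisymm (hj.2 hj.1) (hy j hj.1)
  rw [hzero] at hsum
  refine (Finset.card_le_card fun j hj => ?_).trans hcard
  rw [Finset.mem_filter] at hj
  by_contra hjB
  have hmem : j ∈ R \ B' := Finset.mem_sdiff.2 ⟨hj.1, hjB⟩
  have := Finset.single_le_sum (fun i hi => hz i (Finset.mem_sdiff.1 hi).1) hmem
  linarith [hj.2]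

theorem Dominates.congr (h : Dominates R z y) (hz : ∀ j ∈ R, z j = z' j)
    (hy : ∀ j ∈ R, y j = y' j) : Dominates R z' y' := by
  intro B hB
  obtain ⟨B', hB', hcard, hsum⟩ := h B hB
  refine ⟨B', hB', hcard, ?_⟩
  rwa [← Finset.sum_congr rfl fun j hj => hz j (Finset.mem_sdiff.1 hj).1,
    ← Finset.sum_congr rfl fun j hj => hy j (Finset.mem_sdiff.1 hj).1]

/-- Draining the smallest positive value is the best way of spending `e` units of work. -/
theorem Dominates.drain (h : Dominates R z y) {p : ι} {e : ℝ}
    (hp : 0 < z p) (hmin : ∀ j ∈ R, 0 < z j → z p ≤ z j)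
    (hy' : ∀ j ∈ R, 0 ≤ y' j ∧ y' j ≤ y j) (hye : ∑ j ∈ R, y j - ∑ j ∈ R, y' j ≤ e)
    (hpR : p ∈ R) : Dominates R (Function.update z p (z p - e)) y' := by
  intro B hB
  obtain ⟨B', hB', hcard, hsum⟩ := h B hB
  have hdec : ∑ j ∈ R \ B, y j - e ≤ ∑ j ∈ R \ B, y' j := by
    have h1 := Finset.sum_sdiff (f := fun j => y j - y' j) hB
    have h2 : 0 ≤ ∑ j ∈ B, (y j - y' j) :=
      Finset.sum_nonneg fun j hj => sub_nonneg.2 (hy' j (hB hj)).2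
    rw [← Finset.sum_sub_distrib] at hye
    rw [Finset.sum_sub_distrib (s := R \ B)] at h1
    linarith
  have hnn : 0 ≤ ∑ j ∈ R \ B, y' j :=
    Finset.sum_nonneg fun j hj => (hy' j (Finset.mem_sdiff.1 hj).1).1
  have hupd : ∀ D : Finset ι, p ∈ R \ D →
      ∑ j ∈ R \ D, Function.update z p (z p - e) j = ∑ j ∈ R \ D, z j - e := fun D hD => by
    rw [Finset.sum_update_of_mem hD, ← Finset.add_sum_erase _ _ hD, Finset.sdiff_singleton_eq_erase]
    ring
  by_cases hpB : p ∈ B'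
  · by_cases hex : ∃ r ∈ R \ B', 0 < z r
    -- If the drained `p` was among the removed entries, exchange it for a positive `r`. The kept
    -- sum then changes by `z p - e - z r ≤ -e`.
    · obtain ⟨r, hr, hr0⟩ := hex
      have hrR := (Finset.mem_sdiff.1 hr).1
      have hrB := (Finset.mem_sdiff.1 hr).2
      have hrp : r ≠ p := fun h => hrB (h ▸ hpB)
      have hset : R \ insert r (B'.erase p) = insert p ((R \ B').erase r) := by
        ext j
        simp only [Finset.mem_sdiff, Finset.mem_insert, Finset.mem_erase, not_or, not_and]
        by_cases hjp : j = p
        · subst hjp; simp [hpR, Ne.symm hrp]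
        · simp only [hjp, false_or, not_false_eq_true, true_imp_iff, ne_eq]; tauto
      refine ⟨insert r (B'.erase p), ?_, ?_, ?_⟩
      · exact Finset.insert_subset hrR ((Finset.erase_subset _ _).trans hB')
      · refine (Finset.card_insert_le _ _).trans ?_
        rw [Finset.card_erase_add_one hpB]; exact hcard
      · have hmem : p ∈ R \ insert r (B'.erase p) := by
          rw [hset]; exact Finset.mem_insert_self _ _
        rw [hupd _ hmem, hset, Finset.sum_insert (by simp [hpB])]
        have := Finset.add_sum_erase _ z hr
        linarith [hmin r hrR hr0]
    · push Not at hex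
      refine ⟨B', hB', hcard, le_trans (Finset.sum_nonpos fun j hj => ?_) hnn⟩
      have hjp : j ≠ p := fun h => (Finset.mem_sdiff.1 hj).2 (h ▸ hpB)
      rw [Function.update_of_ne hjp]
      exact hex j hj
  · refine ⟨B', hB', hcard, ?_⟩
    rw [hupd _ (Finset.mem_sdiff.2 ⟨hpR, hpB⟩)]
    linarith

theorem Dominates.of_nonpos (hz : ∀ j ∈ R, z j ≤ 0) (hy : ∀ j ∈ R, 0 ≤ y j) : Dominates R z y :=
  fun B hB => ⟨B, hB, le_rfl, (Finset.sum_nonpos fun j hj => hz j (Finset.mem_sdiff.1 hj).1).trans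
    (Finset.sum_nonneg fun j hj => hy j (Finset.mem_sdiff.1 hj).1)⟩

theorem Dominates.of_subset (h : Dominates R z y) (hR : R ⊆ R') (heq : ∀ j ∈ R' \ R, z j = y j) :
    Dominates R' z y := by
  intro B hB
  obtain ⟨B', hB', hcard, hsum⟩ := h (B ∩ R) Finset.inter_subset_right
  have hdisj : Disjoint B' (B \ R) :=
    Finset.disjoint_left.2 fun j hj hj' => (Finset.mem_sdiff.1 hj').2 (hB' hj)
  refine ⟨B' ∪ (B \ R), Finset.union_subset (hB'.trans hR) (Finset.sdiff_subset.trans hB), ?_, ?_⟩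
  · rw [Finset.card_union_of_disjoint hdisj, ← Finset.card_inter_add_card_sdiff B R]
    omega
  · have e1 : R' \ (B' ∪ (B \ R)) = (R \ B') ∪ ((R' \ R) \ B) := by
      ext j
      simp only [Finset.mem_sdiff, Finset.mem_union, not_or, not_and, not_not]
      have a1 := @hB' j
      have a2 := @hR j
      tauto
    have e2 : R' \ B = (R \ (B ∩ R)) ∪ ((R' \ R) \ B) := by
      ext j
      simp only [Finset.mem_sdiff, Finset.mem_union, Finset.mem_inter]
      have a2 := @hR j
      tauto
    have d : ∀ D : Finset ι, Disjoint (R \ D) ((R' \ R) \ B) := fun D =>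
      Finset.disjoint_left.2 fun j hj hj' =>
        (Finset.mem_sdiff.1 (Finset.mem_sdiff.1 hj').1).2 (Finset.mem_sdiff.1 hj).1
    rw [e1, e2, Finset.sum_union (d _), Finset.sum_union (d _),
      Finset.sum_congr rfl fun j hj => heq j (Finset.mem_sdiff.1 hj).1]
    linarith

end Dominance

/-! ### Cumulative integrals as real functions -/

section Cumulative

/-- The integral of `f` over `(-∞, t]`, as a real number. -/
noncomputable def cumulative (f : ℝ → ℝ≥0∞) (t : ℝ) : ℝ := (∫⁻ u in Iic t, f u).toReal

variable {f : ℝ → ℝ≥0∞}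

theorem setLIntegral_Iic_add_Ioc (f : ℝ → ℝ≥0∞) {s t : ℝ} (hst : s ≤ t) :
    ∫⁻ u in Iic t, f u = (∫⁻ u in Iic s, f u) + ∫⁻ u in Ioc s t, f u := by
  rw [← Iic_union_Ioc_eq_Iic hst, lintegral_union measurableSet_Ioc]
  exact Iic_disjoint_Ioc le_rfl

theorem setLIntegral_Ioc_ne_top (hf : ∀ t, ∫⁻ u in Iic t, f u ≠ ∞) (s t : ℝ) :
    ∫⁻ u in Ioc s t, f u ≠ ∞ :=
  ne_top_of_le_ne_top (hf t) (lintegral_mono_set Ioc_subset_Iic_self)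

theorem cumulative_sub (hf : ∀ t, ∫⁻ u in Iic t, f u ≠ ∞) {s t : ℝ} (hst : s ≤ t) :
    cumulative f t - cumulative f s = (∫⁻ u in Ioc s t, f u).toReal := by
  unfold cumulative
  rw [setLIntegral_Iic_add_Ioc f hst, ENNReal.toReal_add (hf s) (setLIntegral_Ioc_ne_top hf s t)]
  ring

theorem ofReal_cumulative (hf : ∀ t, ∫⁻ u in Iic t, f u ≠ ∞) (t : ℝ) :
    ENNReal.ofReal (cumulative f t) = ∫⁻ u in Iic t, f u := ENNReal.ofReal_toReal (hf t)

theorem cumulative_nonneg (f : ℝ → ℝ≥0∞) (t : ℝ) : 0 ≤ cumulative f t := ENNReal.toReal_nonneg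

theorem cumulative_mono (hf : ∀ t, ∫⁻ u in Iic t, f u ≠ ∞) : Monotone (cumulative f) :=
  fun s t hst => by
    rw [← sub_nonneg, cumulative_sub hf hst]
    exact ENNReal.toReal_nonneg

theorem cumulative_sub_eq_integral (hm : Measurable f) (hf : ∀ t, ∫⁻ u in Iic t, f u ≠ ∞)
    (s t : ℝ) : cumulative f t - cumulative f s = ∫ u in s..t, (f u).toReal := by
  have main : ∀ {s t : ℝ}, s ≤ t →
      cumulative f t - cumulative f s = ∫ u in s..t, (f u).toReal := fun {s t} hst => by
    rw [cumulative_sub hf hst, intervalIntegral.integral_of_le hst,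
      integral_toReal hm.aemeasurable
        (ae_lt_top hm (setLIntegral_Ioc_ne_top hf s t))]
  rcases le_total s t with h | h
  · exact main h
  · rw [intervalIntegral.integral_symm, ← main h]; ring

theorem locallyIntegrable_toReal (hm : Measurable f) (hf : ∀ t, ∫⁻ u in Iic t, f u ≠ ∞) :
    LocallyIntegrable (fun u => (f u).toReal) := by
  intro x
  refine ⟨Iic (x + 1), Iic_mem_nhds (by linarith), ?_⟩
  exact integrable_toReal_of_lintegral_ne_top hm.aemeasurable (hf _)

theorem continuous_cumulative (hm : Measurable f) (hf : ∀ t, ∫⁻ u in Iic t, f u ≠ ∞) :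
    Continuous (cumulative f) := by
  have h := intervalIntegral.continuous_primitive (μ := volume) (f := fun u => (f u).toReal)
    (fun a b => ((locallyIntegrable_toReal hm hf).integrableOn_isCompact
      isCompact_uIcc).intervalIntegrable) 0
  have e : cumulative f = fun t => cumulative f 0 + ∫ u in (0 : ℝ)..t, (f u).toReal := by
    ext t
    rw [← cumulative_sub_eq_integral hm hf]; ring
  rw [e]
  exact continuous_const.add h

end Cumulative

theorem IsPowerFunction.measurable_ofReal_comp {P : ℝ → ℝ} (hP : IsPowerFunction P) {α : Type*}
    [MeasurableSpace α] {f : α → ℝ} (hf : Measurable f) (h0 : ∀ a, 0 ≤ f a) :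
    Measurable fun a => ENNReal.ofReal (P (f a)) := by
  have hm : Monotone fun s => P (max 0 s) := fun s t hst =>
    hP.strictMonoOn.monotoneOn (mem_Ici.2 (le_max_left _ _)) (mem_Ici.2 (le_max_left _ _))
      (max_le_max le_rfl hst)
  have e : (fun a => ENNReal.ofReal (P (f a))) = fun a => ENNReal.ofReal (P (max 0 (f a))) := by
    ext a; rw [max_eq_right (h0 a)]
  rw [e]
  exact (hm.measurable.comp hf).ennreal_ofReal

/-! ### Remaining sizes, completions and lower bounds for the cost -/

namespace JobSequence

theorem exists_lt_arrival {J : ℕ} (I : JobSequence J) : ∃ t₀, ∀ j, t₀ < I.arrival j := by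
  obtain ⟨b, hb⟩ := (Set.finite_range I.arrival).bddBelow
  exact ⟨b - 1, fun j => by linarith [hb (mem_range_self j)]⟩

/-- The jobs that are released by time `t`. -/
noncomputable def released {J : ℕ} (I : JobSequence J) (t : ℝ) : Finset (Fin J) :=
  Finset.univ.filter fun j => I.arrival j ≤ t

theorem mem_released {J : ℕ} {I : JobSequence J} {t : ℝ} {j : Fin J} :
    j ∈ I.released t ↔ I.arrival j ≤ t := by simp [released]

theorem released_mono {J : ℕ} (I : JobSequence J) : Monotone I.released := fun _ _ h _ hj =>
  mem_released.2 ((mem_released.1 hj).trans h)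

end JobSequence

namespace Schedule

variable {J : ℕ} {I : JobSequence J} {m : ℕ} (S : Schedule I m)

/-- The rate at which job `j` is processed at time `u`. -/
noncomputable def rate (j : Fin J) (u : ℝ) : ℝ≥0∞ :=
  ∑ k, if S.job k u = some j then ENNReal.ofReal (S.speed k u) else 0

/-- The total speed of the servers at time `u`. -/
noncomputable def totalSpeed (u : ℝ) : ℝ≥0∞ := ∑ k, ENNReal.ofReal (S.speed k u)

theorem measurable_rate (j : Fin J) : Measurable (S.rate j) :=
  Finset.measurable_sum _ fun k _ => Measurable.ite (S.measurableSet_job k j)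
    (S.measurable_speed k).ennreal_ofReal measurable_const

theorem measurable_totalSpeed : Measurable S.totalSpeed :=
  Finset.measurable_sum _ fun k _ => (S.measurable_speed k).ennreal_ofReal

theorem sum_ite_job_le {S : Schedule I m} (u : ℝ) (R : Finset (Fin J)) (F : Fin m → ℝ≥0∞) :
    ∑ j ∈ R, ∑ k, (if S.job k u = some j then F k else 0) ≤ ∑ k, F k := by
  rw [Finset.sum_comm]
  refine Finset.sum_le_sum fun k _ => ?_
  cases h : S.job k u with
  | none => simp
  | some i =>
    simp only [Option.some.injEq]
    rw [Finset.sum_ite_eq]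
    split_ifs <;> simp

theorem sum_rate_le (R : Finset (Fin J)) (u : ℝ) : ∑ j ∈ R, S.rate j u ≤ S.totalSpeed u :=
  sum_ite_job_le u R _

theorem rate_le (j : Fin J) (u : ℝ) : S.rate j u ≤ S.totalSpeed u := by
  simpa using S.sum_rate_le {j} u

theorem work_eq (j : Fin J) (t : ℝ) : S.work j t = ∫⁻ u in Iic t, S.rate j u := rfl

theorem rate_eq_zero {j : Fin J} {u : ℝ} (hu : u < I.arrival j) : S.rate j u = 0 := by
  refine Finset.sum_eq_zero fun k _ => if_neg fun h => ?_
  exact absurd (S.released k u j h) (not_le.2 hu)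

theorem totalSpeed_eq_zero {u : ℝ} (hu : ∀ j, u < I.arrival j) : S.totalSpeed u = 0 := by
  refine Finset.sum_eq_zero fun k _ => ?_
  rw [S.speed_idle k u, ENNReal.ofReal_zero]
  cases h : S.job k u with
  | none => rfl
  | some j => exact absurd (S.released k u j h) (not_le.2 (hu j))

theorem work_mono (j : Fin J) : Monotone (S.work j) := fun _ _ h =>
  lintegral_mono_set (Iic_subset_Iic.2 h)

theorem work_eq_zero {j : Fin J} {t : ℝ} (ht : t ≤ I.arrival j) : S.work j t = 0 := by
  rw [work_eq, setLIntegral_congr Iio_ae_eq_Iic.symm]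
  exact (setLIntegral_congr_fun measurableSet_Iio fun u hu =>
    S.rate_eq_zero (lt_of_lt_of_le hu ht)).trans (by simp)

theorem mem_unfinished {j : Fin J} {t : ℝ} :
    j ∈ S.unfinished t ↔ I.arrival j ≤ t ∧ S.work j t < ENNReal.ofReal (I.size j) := by
  simp [unfinished]

theorem mem_served {j : Fin J} {t : ℝ} : j ∈ S.served t ↔ ∃ k, S.job k t = some j := by
  simp [served]

theorem measurableSet_mem_unfinished (j : Fin J) : MeasurableSet {t | j ∈ S.unfinished t} := by
  simp_rw [mem_unfinished]
  exact measurableSet_Ici.inter (measurableSet_lt (S.work_mono j).measurable measurable_const)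

theorem numUnfinished_eq_sum (t : ℝ) : (S.numUnfinished t : ℝ≥0∞) =
    ∑ j, {t | j ∈ S.unfinished t}.indicator (fun _ => 1) t := by
  simp [numUnfinished, indicator_apply]

theorem measurable_numUnfinished : Measurable fun t => (S.numUnfinished t : ℝ≥0∞) := by
  simp_rw [numUnfinished_eq_sum]
  exact Finset.measurable_sum _ fun j _ =>
    measurable_const.indicator (S.measurableSet_mem_unfinished j)

theorem numUnfinished_le (t : ℝ) : S.numUnfinished t ≤ J :=
  (Finset.card_le_univ _).trans_eq (Fintype.card_fin J)

/-- The work done in every bounded time interval is finite. -/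
def HasFiniteWork : Prop := ∀ t, ∫⁻ u in Iic t, S.totalSpeed u ≠ ∞

variable {S}

theorem HasFiniteWork.rate (hS : S.HasFiniteWork) (j : Fin J) (t : ℝ) :
    ∫⁻ u in Iic t, S.rate j u ≠ ∞ :=
  ne_top_of_le_ne_top (hS t) (lintegral_mono fun u => S.rate_le j u)

theorem hasFiniteWork_of_le {f : ℝ → ℝ≥0∞} (h : ∀ u, S.totalSpeed u ≤ f u)
    (hf : ∀ s t, ∫⁻ u in Ioc s t, f u ≠ ∞) : S.HasFiniteWork := by
  intro t
  obtain ⟨t₀, ht₀⟩ := I.exists_lt_arrival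
  have h0 : ∀ s, s ≤ t₀ → ∫⁻ u in Iic s, S.totalSpeed u = 0 := fun s hs =>
    (setLIntegral_congr_fun measurableSet_Iic fun u hu =>
      S.totalSpeed_eq_zero fun j => (hu.trans hs).trans_lt (ht₀ j)).trans (by simp)
  rcases le_total t t₀ with ht | ht
  · rw [h0 t ht]; simp
  · rw [setLIntegral_Iic_add_Ioc _ ht, h0 t₀ le_rfl, zero_add]
    exact ne_top_of_le_ne_top (hf t₀ t) (lintegral_mono h)

variable (S) in
/-- The remaining size of job `j` at time `t`, as a real number. -/
noncomputable def rem (j : Fin J) (t : ℝ) : ℝ := max 0 (I.size j - cumulative (S.rate j) t)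

theorem rem_nonneg (j : Fin J) (t : ℝ) : 0 ≤ S.rem j t := le_max_left _ _

theorem rem_le (j : Fin J) (t : ℝ) : S.rem j t ≤ I.size j :=
  max_le (I.size_pos j).le (by linarith [cumulative_nonneg (S.rate j) t])

theorem work_lt_iff (hS : S.HasFiniteWork) (j : Fin J) (t : ℝ) :
    S.work j t < ENNReal.ofReal (I.size j) ↔ cumulative (S.rate j) t < I.size j := by
  rw [work_eq, ← ofReal_cumulative (hS.rate j), ENNReal.ofReal_lt_ofReal_iff (I.size_pos j)]

theorem rem_pos_iff (hS : S.HasFiniteWork) (j : Fin J) (t : ℝ) :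
    0 < S.rem j t ↔ S.work j t < ENNReal.ofReal (I.size j) := by
  rw [work_lt_iff hS, rem, lt_max_iff, sub_pos]
  simp

theorem remaining_eq (hS : S.HasFiniteWork) (j : Fin J) (t : ℝ) :
    S.remaining j t = ENNReal.ofReal (S.rem j t) := by
  rw [remaining, work_eq, ← ofReal_cumulative (hS.rate j),
    ← ENNReal.ofReal_sub _ (cumulative_nonneg _ _), rem, ENNReal.ofReal_max]
  simp

theorem rem_eq_size {j : Fin J} {t : ℝ} (ht : t ≤ I.arrival j) : S.rem j t = I.size j := by
  have : cumulative (S.rate j) t = 0 := by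
    rw [cumulative, ← work_eq, S.work_eq_zero ht]; rfl
  rw [rem, this, sub_zero, max_eq_right (I.size_pos j).le]

theorem rem_antitone (hS : S.HasFiniteWork) (j : Fin J) : Antitone (S.rem j) := fun _ _ h =>
  max_le_max le_rfl (by linarith [cumulative_mono (hS.rate j) h])

theorem countAbove_rem (hS : S.HasFiniteWork) (t : ℝ) :
    countAbove (I.released t) (S.rem · t) 0 = S.numUnfinished t := by
  unfold countAbove numUnfinished
  congr 1
  ext j
  rw [Finset.mem_filter, mem_unfinished, JobSequence.mem_released, rem_pos_iff hS]

theorem sum_rem_sub_le (hS : S.HasFiniteWork) (R : Finset (Fin J)) {s t : ℝ} (hst : s ≤ t) :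
    ∑ j ∈ R, S.rem j s - ∑ j ∈ R, S.rem j t ≤
      cumulative S.totalSpeed t - cumulative S.totalSpeed s := by
  have h1 : ∀ j, S.rem j s - S.rem j t ≤ (∫⁻ u in Ioc s t, S.rate j u).toReal := fun j => by
    rw [← cumulative_sub (hS.rate j) hst]
    have := cumulative_mono (hS.rate j) hst
    unfold rem
    rcases max_cases 0 (I.size j - cumulative (S.rate j) s) with h | h <;>
    rcases max_cases 0 (I.size j - cumulative (S.rate j) t) with h' | h' <;> linarith
  rw [← Finset.sum_sub_distrib, cumulative_sub hS hst]
  refine (Finset.sum_le_sum fun j _ => h1 j).trans ?_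
  rw [← ENNReal.toReal_sum fun j _ => setLIntegral_Ioc_ne_top (hS.rate j) s t,
    ← lintegral_finsetSum _ fun j _ => S.measurable_rate j]
  exact ENNReal.toReal_mono (setLIntegral_Ioc_ne_top hS s t)
    (lintegral_mono fun u => S.sum_rate_le R u)

/-- The first time at which job `j` is complete. -/
theorem exists_completion (hS : S.HasFiniteWork) {j : Fin J} {t : ℝ}
    (ht : ENNReal.ofReal (I.size j) ≤ S.work j t) :
    ∃ c ≤ t, I.arrival j < c ∧ ∀ u, S.work j u < ENNReal.ofReal (I.size j) ↔ u < c := by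
  set D : Set ℝ := {u | I.size j ≤ cumulative (S.rate j) u} with hD
  have hmem : ∀ u, u ∈ D ↔ ENNReal.ofReal (I.size j) ≤ S.work j u := fun u => by
    rw [← not_lt, work_lt_iff hS, not_lt]; rfl
  have hlow : ∀ u ∈ D, I.arrival j ≤ u := fun u hu => by
    by_contra h
    rw [hmem, S.work_eq_zero (not_le.1 h).le, nonpos_iff_eq_zero, ENNReal.ofReal_eq_zero] at hu
    exact absurd hu (not_le.2 (I.size_pos j))
  have hbdd : BddBelow D := ⟨_, hlow⟩
  have hcl : IsClosed D :=
    isClosed_le continuous_const (continuous_cumulative (S.measurable_rate j) (hS.rate j))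
  have htD : t ∈ D := (hmem t).2 ht
  have hc := hcl.csInf_mem ⟨t, htD⟩ hbdd
  refine ⟨sInf D, csInf_le hbdd htD, lt_of_le_of_ne (hlow _ hc) fun h => ?_, fun u => ?_⟩
  · rw [hmem, ← h, S.work_eq_zero le_rfl, nonpos_iff_eq_zero, ENNReal.ofReal_eq_zero] at hc
    exact absurd hc (not_le.2 (I.size_pos j))
  · rw [← not_le, ← hmem, ← not_le]
    exact not_congr ⟨fun h => csInf_le hbdd h, fun h =>
      (hmem u).2 (((hmem _).1 hc).trans (S.work_mono j h))⟩

/-- The power consumed at time `t`. -/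
noncomputable def power (P : ℝ → ℝ) (S : Schedule I m) (t : ℝ) : ℝ≥0∞ :=
  ∑ k, ENNReal.ofReal (P (S.speed k t))

variable {P : ℝ → ℝ}

theorem measurable_power (hP : IsPowerFunction P) (S : Schedule I m) : Measurable (S.power P) :=
  Finset.measurable_sum _ fun k _ =>
    hP.measurable_ofReal_comp (S.measurable_speed k) (S.speed_nonneg k)

theorem cost_eq (S : Schedule I m) :
    S.cost P = ∫⁻ t, ((S.numUnfinished t : ℝ≥0∞) + S.power P t) :=
  (lintegral_add_left S.measurable_numUnfinished _).symm

/-- Since `s ≤ 1 + P s`, the total speed is at most `m` plus the power. -/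
theorem hasFiniteWork_of_cost_ne_top (hP : IsPowerFunction P) (hS : S.cost P ≠ ∞) :
    S.HasFiniteWork := by
  refine hasFiniteWork_of_le (f := fun u => m + S.power P u) (fun u => ?_) fun s t => ?_
  · have : (m : ℝ≥0∞) = ∑ _k : Fin m, 1 := by simp
    rw [this, power, ← Finset.sum_add_distrib]
    refine Finset.sum_le_sum fun k _ => ?_
    rw [← ENNReal.ofReal_one,
      ← ENNReal.ofReal_add zero_le_one (hP.nonneg (S.speed_nonneg k u))]
    exact ENNReal.ofReal_le_ofReal (hP.le_one_add_map (S.speed_nonneg k u))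
  · rw [lintegral_add_left measurable_const]
    refine ENNReal.add_ne_top.2 ⟨by simp [ENNReal.mul_eq_top], ?_⟩
    refine ne_top_of_le_ne_top hS ((setLIntegral_le_lintegral _ _).trans ?_)
    exact le_add_self

theorem sum_ite_speed_le (hP : IsPowerFunction P) (j : Fin J) (u : ℝ) : S.rate j u ≤
    1 + ∑ k, if S.job k u = some j then ENNReal.ofReal (P (S.speed k u)) else 0 := by
  by_cases h : ∃ k, S.job k u = some j
  · obtain ⟨k, hk⟩ := h
    have hone : ∀ F : Fin m → ℝ≥0∞, ∑ k', (if S.job k' u = some j then F k' else 0) = F k :=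
      fun F => by
        rw [Finset.sum_eq_single k (fun k' _ hne => if_neg fun h => hne
          (S.no_split k' k u j h hk)) (fun h => absurd (Finset.mem_univ k) h), if_pos hk]
    rw [rate, hone, hone, ← ENNReal.ofReal_one,
      ← ENNReal.ofReal_add zero_le_one (hP.nonneg (S.speed_nonneg k u))]
    exact ENNReal.ofReal_le_ofReal (hP.le_one_add_map (S.speed_nonneg k u))
  · push Not at h
    rw [rate, Finset.sum_eq_zero fun k _ => if_neg (h k)]
    exact zero_le

/-- Processing a unit of work costs at least `1`. -/
theorem sum_size_le_cost (hP : IsPowerFunction P) (S : Schedule I m) :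
    ENNReal.ofReal (∑ j, I.size j) ≤ S.cost P := by
  by_cases htop : S.cost P = ∞
  · rw [htop]; exact le_top
  have hS := hasFiniteWork_of_cost_ne_top hP htop
  have hjob : ∀ j, ENNReal.ofReal (I.size j) ≤
      ∫⁻ u, {t | j ∈ S.unfinished t}.indicator (S.rate j) u := fun j => by
    -- A job that never completes contributes flow time at rate `1` forever, making the cost
    -- infinite.
    have hex : ∃ t, ENNReal.ofReal (I.size j) ≤ S.work j t := by
      by_contra hcon
      push Not at hcon
      refine htop (top_le_iff.1 ?_)
      calc (∞ : ℝ≥0∞) = ∫⁻ _ in Ici (I.arrival j), 1 := by simp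
        _ ≤ ∫⁻ t in Ici (I.arrival j), (S.numUnfinished t : ℝ≥0∞) := by
          refine setLIntegral_mono' measurableSet_Ici fun t ht => ?_
          have : 1 ≤ S.numUnfinished t :=
            Finset.card_pos.2 ⟨j, S.mem_unfinished.2 ⟨ht, hcon t⟩⟩
          exact_mod_cast this
        _ ≤ S.cost P := (setLIntegral_le_lintegral _ _).trans le_self_add
    obtain ⟨t, ht⟩ := hex
    obtain ⟨c, -, -, hc⟩ := exists_completion hS ht
    calc ENNReal.ofReal (I.size j) ≤ S.work j c := not_lt.1 fun h => lt_irrefl c ((hc c).1 h)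
      _ = ∫⁻ u in Iio c, S.rate j u := by
        rw [work_eq, setLIntegral_congr Iio_ae_eq_Iic.symm]
      _ ≤ ∫⁻ u in Iio c, {t | j ∈ S.unfinished t}.indicator (S.rate j) u := by
        refine setLIntegral_mono' measurableSet_Iio fun u hu => ?_
        rcases lt_or_ge u (I.arrival j) with h | h
        · rw [S.rate_eq_zero h]; exact zero_le
        · rw [indicator_of_mem (show u ∈ {t | j ∈ S.unfinished t} from
            S.mem_unfinished.2 ⟨h, (hc u).2 hu⟩)]
      _ ≤ _ := setLIntegral_le_lintegral _ _
  rw [ENNReal.ofReal_sum_of_nonneg fun j _ => (I.size_pos j).le]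
  refine (Finset.sum_le_sum fun j _ => hjob j).trans ?_
  rw [← lintegral_finsetSum _ fun j _ =>
    (S.measurable_rate j).indicator (S.measurableSet_mem_unfinished j), cost_eq]
  refine lintegral_mono fun u => ?_
  -- Only work before completion is counted, so the ones add up to `n(u)`. As no job is split, each
  -- job needs a single `1` on its side of the estimate.
  have e : ∀ j, {t | j ∈ S.unfinished t}.indicator (S.rate j) u ≤
      {t | j ∈ S.unfinished t}.indicator (fun _ => 1) u +
        ∑ k, if S.job k u = some j then ENNReal.ofReal (P (S.speed k u)) else 0 := fun j => by
    by_cases h : u ∈ {t | j ∈ S.unfinished t}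
    · rw [indicator_of_mem h, indicator_of_mem h]; exact sum_ite_speed_le hP j u
    · rw [indicator_of_notMem h]; exact zero_le
  refine (Finset.sum_le_sum fun j _ => e j).trans ?_
  rw [Finset.sum_add_distrib, ← numUnfinished_eq_sum]
  gcongr
  exact sum_ite_job_le u _ _

theorem lintegral_Iic_cost_ne_top (hS : S.cost P ≠ ∞) (t : ℝ) :
    ∫⁻ u in Iic t, ((S.numUnfinished u : ℝ≥0∞) + S.power P u) ≠ ∞ := by
  rw [cost_eq] at hS
  exact ne_top_of_le_ne_top hS (setLIntegral_le_lintegral _ _)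

/-- Lower bound for the cost of a schedule over a time interval, by a supporting line of `P`. -/
theorem le_cumulative_cost_sub (hP : IsPowerFunction P) (hS : S.cost P ≠ ∞) {C c μ : ℝ}
    (hC : 0 ≤ C) (hc : 0 ≤ c) (hline : ∀ s, 0 ≤ s → c * s ≤ C * P s + μ) {r t : ℝ} (hrt : r ≤ t)
    {k : ℕ} (hk : ∀ u ∈ Ioo r t, k ≤ S.numUnfinished u) :
    C * k * (t - r) + c * (cumulative S.totalSpeed t - cumulative S.totalSpeed r) ≤
      C * (cumulative (fun u => (S.numUnfinished u : ℝ≥0∞) + S.power P u) t -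
        cumulative (fun u => (S.numUnfinished u : ℝ≥0∞) + S.power P u) r) + m * μ * (t - r) := by
  have hfin := hasFiniteWork_of_cost_ne_top hP hS
  have hcost := lintegral_Iic_cost_ne_top hS
  have hμ : 0 ≤ μ := by simpa [hP.map_zero] using hline 0 le_rfl
  have hmc : Measurable fun u => (S.numUnfinished u : ℝ≥0∞) + S.power P u :=
    S.measurable_numUnfinished.add (measurable_power hP S)
  have hspeed : ∀ u, ENNReal.ofReal c * S.totalSpeed u ≤
      ENNReal.ofReal C * S.power P u + ENNReal.ofReal (m * μ) := fun u => by
    have e : ENNReal.ofReal (m * μ) = ∑ _k : Fin m, ENNReal.ofReal μ := by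
      rw [Finset.sum_const, Finset.card_univ, Fintype.card_fin, nsmul_eq_mul,
        ENNReal.ofReal_mul (Nat.cast_nonneg _), ENNReal.ofReal_natCast]
    rw [totalSpeed, power, e, Finset.mul_sum, Finset.mul_sum, ← Finset.sum_add_distrib]
    refine Finset.sum_le_sum fun i _ => ?_
    have h0 := hP.nonneg (S.speed_nonneg i u)
    rw [← ENNReal.ofReal_mul hc, ← ENNReal.ofReal_mul hC,
      ← ENNReal.ofReal_add (mul_nonneg hC h0) hμ]
    exact ENNReal.ofReal_le_ofReal (hline _ (S.speed_nonneg i u))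
  have hvol : volume (Ioo r t) = ENNReal.ofReal (t - r) := Real.volume_Ioo
  have key : ENNReal.ofReal (C * k) * ENNReal.ofReal (t - r) +
        ENNReal.ofReal c * ∫⁻ u in Ioc r t, S.totalSpeed u ≤
      ENNReal.ofReal C * (∫⁻ u in Ioc r t, ((S.numUnfinished u : ℝ≥0∞) + S.power P u)) +
        ENNReal.ofReal (m * μ) * ENNReal.ofReal (t - r) := by
    rw [setLIntegral_congr (f := S.totalSpeed) Ioo_ae_eq_Ioc.symm,
      setLIntegral_congr (f := fun u => (S.numUnfinished u : ℝ≥0∞) + S.power P u)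
        Ioo_ae_eq_Ioc.symm, ← hvol, ← setLIntegral_const, ← setLIntegral_const,
      ← lintegral_const_mul _ S.measurable_totalSpeed, ← lintegral_const_mul _ hmc,
      ← lintegral_add_left measurable_const, ← lintegral_add_left (hmc.const_mul _)]
    refine setLIntegral_mono' measurableSet_Ioo fun u hu => ?_
    have h1 : ENNReal.ofReal (C * k) ≤ ENNReal.ofReal C * (S.numUnfinished u : ℝ≥0∞) := by
      rw [ENNReal.ofReal_mul hC, ENNReal.ofReal_natCast]
      gcongr
      exact hk u hu
    calc _ ≤ ENNReal.ofReal C * (S.numUnfinished u : ℝ≥0∞) +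
          (ENNReal.ofReal C * S.power P u + ENNReal.ofReal (m * μ)) := add_le_add h1 (hspeed u)
      _ = _ := by rw [mul_add, add_assoc]
  have hA := setLIntegral_Ioc_ne_top hfin r t
  have hB := setLIntegral_Ioc_ne_top hcost r t
  have key' := ENNReal.toReal_mono (ENNReal.add_ne_top.2
    ⟨ENNReal.mul_ne_top ENNReal.ofReal_ne_top hB,
      ENNReal.mul_ne_top ENNReal.ofReal_ne_top ENNReal.ofReal_ne_top⟩) key
  rw [ENNReal.toReal_add (ENNReal.mul_ne_top ENNReal.ofReal_ne_top ENNReal.ofReal_ne_top)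
      (ENNReal.mul_ne_top ENNReal.ofReal_ne_top hA),
    ENNReal.toReal_add (ENNReal.mul_ne_top ENNReal.ofReal_ne_top hB)
      (ENNReal.mul_ne_top ENNReal.ofReal_ne_top ENNReal.ofReal_ne_top)] at key'
  simp only [ENNReal.toReal_mul] at key'
  rw [ENNReal.toReal_ofReal (by positivity), ENNReal.toReal_ofReal (sub_nonneg.2 hrt),
    ENNReal.toReal_ofReal hc, ENNReal.toReal_ofReal hC, ENNReal.toReal_ofReal (by positivity),
    ← cumulative_sub hfin hrt, ← cumulative_sub hcost hrt] at key'
  exact key'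

end Schedule

/-! ### SRPT between events: ties and constancy of the served set -/

/-- A locally integrable function vanishes almost everywhere on each level set of its primitive. -/
theorem ae_eq_zero_of_primitive_eq {h : ℝ → ℝ} (hh : LocallyIntegrable h) (a c : ℝ) :
    ∀ᵐ u, (∫ v in a..u, h v) = c → h u = 0 := by
  set D : ℝ → ℝ := fun u => ∫ v in a..u, h v
  set Z : Set ℝ := {u | D u = c}
  -- Only countably many points of `Z` are isolated from the right. At any other point of `Z` a
  -- nonzero derivative would keep the primitive off `c` in a punctured neighbourhood.
  have hcount := (countable_setOfPred_isolated_right_within (s := Z)).ae_notMem volume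
  filter_upwards [LocallyIntegrable.ae_hasDerivAt_integral hh, hcount] with u hu hiso hZ
  by_contra hne
  refine hiso ⟨hZ, ?_⟩
  have hev := (hu a).eventually_ne (c := c) hne
  rw [← Filter.empty_mem_iff_bot]
  have hle : nhdsWithin u (Z ∩ Ioi u) ≤ nhdsWithin u {u}ᶜ :=
    nhdsWithin_mono u fun v hv => ne_of_gt hv.2
  filter_upwards [hle hev, self_mem_nhdsWithin] with v hv hvZ
  exact hv hvZ.1

namespace Schedule

variable {J : ℕ} {I : JobSequence J} {m : ℕ} {S : Schedule I m} {P : ℝ → ℝ}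

theorem numUnfinished_eq_zero {t : ℝ} (ht : ∀ j, t < I.arrival j) : S.numUnfinished t = 0 := by
  rw [numUnfinished, Finset.card_eq_zero]
  refine Finset.eq_empty_of_forall_notMem fun j hj => ?_
  exact absurd (S.mem_unfinished.1 hj).1 (not_le.2 (ht j))

variable (S) in
theorem lintegral_Iic_numUnfinished_ne_top (t : ℝ) :
    ∫⁻ u in Iic t, (S.numUnfinished u : ℝ≥0∞) ≠ ∞ := by
  obtain ⟨t₀, ht₀⟩ := I.exists_lt_arrival
  refine ne_top_of_le_ne_top (b := ∫⁻ u in Iic t, (Ici t₀).indicator (fun _ => (J : ℝ≥0∞)) u)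
    ?_ (lintegral_mono fun u => ?_)
  · rw [lintegral_indicator_const measurableSet_Ici,
      Measure.restrict_apply measurableSet_Ici, Ici_inter_Iic, Real.volume_Icc]
    exact ENNReal.mul_ne_top (by simp) (by simp)
  · rcases lt_or_ge u t₀ with h | h
    · rw [numUnfinished_eq_zero fun j => h.trans (ht₀ j)]; simp
    · rw [indicator_of_mem (mem_Ici.2 h)]
      exact Nat.cast_le.2 (S.numUnfinished_le u)

/-- Finitely many times that contain all arrivals and completions. -/
theorem exists_events (S : Schedule I m) : ∃ F : Finset ℝ, (∀ j, I.arrival j ∈ F) ∧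
    ∀ j c, (∀ u, S.work j u < ENNReal.ofReal (I.size j) ↔ u < c) → c ∈ F := by
  classical
  have h : ∀ j, ∃ c₀ : ℝ, ∀ c, (∀ u, S.work j u < ENNReal.ofReal (I.size j) ↔ u < c) → c = c₀ :=
    fun j => by
      by_cases hex : ∃ c, ∀ u, S.work j u < ENNReal.ofReal (I.size j) ↔ u < c
      · obtain ⟨c₀, hc₀⟩ := hex
        refine ⟨c₀, fun c hc => eq_of_forall_lt_iff fun u => ?_⟩
        rw [← hc, hc₀]
      · exact ⟨0, fun c hc => absurd ⟨c, hc⟩ hex⟩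
  choose c₀ hc₀ using h
  refine ⟨Finset.univ.image I.arrival ∪ Finset.univ.image c₀, fun j => ?_, fun j c hc => ?_⟩
  · exact Finset.mem_union_left _ (Finset.mem_image_of_mem _ (Finset.mem_univ j))
  · rw [hc₀ j c hc]
    exact Finset.mem_union_right _ (Finset.mem_image_of_mem _ (Finset.mem_univ j))

section NoEvents

variable {F : Finset ℝ} {r t : ℝ}

theorem arrival_le_iff_of_no_events (hF : ∀ j, I.arrival j ∈ F) (hrt : Disjoint (F : Set ℝ) (Ioo r t))
    {u : ℝ} (hu : u ∈ Ico r t) (j : Fin J) : I.arrival j ≤ u ↔ I.arrival j ≤ r := by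
  refine ⟨fun h => ?_, fun h => h.trans hu.1⟩
  by_contra h'
  exact Set.disjoint_left.1 hrt (hF j) ⟨not_le.1 h', h.trans_lt hu.2⟩

theorem unfinished_eq_of_no_events (hS : S.HasFiniteWork) (hF : ∀ j, I.arrival j ∈ F)
    (hF' : ∀ j c, (∀ u, S.work j u < ENNReal.ofReal (I.size j) ↔ u < c) → c ∈ F)
    (hrt : Disjoint (F : Set ℝ) (Ioo r t)) {u : ℝ} (hu : u ∈ Ico r t) :
    S.unfinished u = S.unfinished r := by
  ext j
  rw [mem_unfinished, mem_unfinished, arrival_le_iff_of_no_events hF hrt hu]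
  refine and_congr_right fun _ => ⟨fun h => (S.work_mono j hu.1).trans_lt h, fun h => ?_⟩
  by_contra h'
  obtain ⟨c, hcu, -, hc⟩ := exists_completion hS (not_lt.1 h')
  exact Set.disjoint_left.1 hrt (hF' j c hc) ⟨(hc r).1 h, hcu.trans_lt hu.2⟩

end NoEvents

namespace IsSRPT

theorem rate_eq (h : S.IsSRPT P) (j : Fin J) (u : ℝ) : S.rate j u =
    if j ∈ S.served u then ENNReal.ofReal (speedRule P m (S.numUnfinished u)) else 0 := by
  split_ifs with hj
  · obtain ⟨k, hk⟩ := S.mem_served.1 hj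
    rw [rate, Finset.sum_eq_single k (fun k' _ hne => if_neg fun h => hne
      (S.no_split k' k u j h hk)) (fun h => absurd (Finset.mem_univ k) h), if_pos hk,
      h.speed_eq u k (by rw [hk]; simp)]
  · exact Finset.sum_eq_zero fun k _ => if_neg fun hk => hj (S.mem_served.2 ⟨k, hk⟩)

theorem hasFiniteWork (hP : IsPowerFunction P) (hm : 1 ≤ m) (h : S.IsSRPT P) :
    S.HasFiniteWork := by
  set B := ∑ n ∈ Finset.range (J + 1), speedRule P m n with hB
  refine hasFiniteWork_of_le (f := fun _ => m * ENNReal.ofReal B) (fun u => ?_) fun s t => ?_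
  · have : (m : ℝ≥0∞) * ENNReal.ofReal B = ∑ _k : Fin m, ENNReal.ofReal B := by simp
    rw [this]
    refine Finset.sum_le_sum fun k _ => ENNReal.ofReal_le_ofReal ?_
    by_cases hk : S.job k u = none
    · rw [S.speed_idle k u hk]
      exact Finset.sum_nonneg fun n _ => (speedRule_pos hP hm n).le
    · rw [h.speed_eq u k hk]
      exact Finset.single_le_sum (f := fun n => speedRule P m n)
        (fun n _ => (speedRule_pos hP hm n).le)
        (Finset.mem_range.2 (Nat.lt_succ_of_le (S.numUnfinished_le u)))
  · rw [setLIntegral_const]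
    exact ENNReal.mul_ne_top (ENNReal.mul_ne_top (by simp) (by simp)) (by simp)

theorem card_busy (h : S.IsSRPT P) (t : ℝ) :
    (Finset.univ.filter fun k => S.job k t ≠ none).card = min m (S.numUnfinished t) := by
  classical
  rw [← h.card_served t]
  have himg : (Finset.univ.filter fun k => S.job k t ≠ none).image (fun k => S.job k t) =
      (S.served t).map Function.Embedding.some := by
    ext o
    simp only [Finset.mem_image, Finset.mem_filter, Finset.mem_univ, true_and, Finset.mem_map,
      mem_served, Function.Embedding.some_apply]
    constructor
    · rintro ⟨k, hk, rfl⟩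
      obtain ⟨j, hj⟩ := Option.ne_none_iff_exists'.1 hk
      exact ⟨j, ⟨k, hj⟩, hj.symm⟩
    · rintro ⟨j, ⟨k, hk⟩, rfl⟩
      exact ⟨k, by rw [hk]; simp, hk⟩
  rw [← Finset.card_map (s := S.served t) Function.Embedding.some, ← himg, Finset.card_image_of_injOn]
  intro k hk k' _ hkk'
  rw [Finset.mem_coe, Finset.mem_filter] at hk
  obtain ⟨j, hj⟩ := Option.ne_none_iff_exists'.1 hk.2
  exact S.no_split k k' t j hj (by rw [← hj]; exact hkk'.symm)

/-- The speed rule is chosen for this balance: `m` servers at power `n / m`, or `n < m` servers at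
power `1`. -/
theorem power_eq (hP : IsPowerFunction P) (hm : 1 ≤ m) (h : S.IsSRPT P) (t : ℝ) :
    S.power P t = S.numUnfinished t := by
  have hm0 : (0 : ℝ) < m := by exact_mod_cast hm
  have e : ∀ k, ENNReal.ofReal (P (S.speed k t)) = if S.job k t ≠ none then
      ENNReal.ofReal (P (speedRule P m (S.numUnfinished t))) else 0 := fun k => by
    split_ifs with hk
    · rw [h.speed_eq t k hk]
    · rw [S.speed_idle k t (not_not.1 hk), hP.map_zero, ENNReal.ofReal_zero]
  unfold power
  simp_rw [e]
  rw [← Finset.sum_filter, Finset.sum_const, h.card_busy, nsmul_eq_mul, ← ENNReal.ofReal_natCast,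
    ← ENNReal.ofReal_mul (Nat.cast_nonneg _), ← ENNReal.ofReal_natCast]
  congr 1
  unfold speedRule
  split_ifs with hmn
  · rw [hP.map_powerInv (by positivity), min_eq_left hmn]
    field_simp
  · rw [hP.map_powerInv zero_le_one, min_eq_right (not_le.1 hmn).le, mul_one]

theorem cost_eq (hP : IsPowerFunction P) (hm : 1 ≤ m) (h : S.IsSRPT P) :
    S.cost P = 2 * ∫⁻ t, (S.numUnfinished t : ℝ≥0∞) := by
  rw [Schedule.cost_eq, ← lintegral_const_mul _ S.measurable_numUnfinished]
  refine lintegral_congr fun t => ?_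
  rw [h.power_eq hP hm, two_mul]

variable {r t : ℝ}

theorem rem_eq_sub (hP : IsPowerFunction P) (hm : 1 ≤ m) (h : S.IsSRPT P)
    (hU : ∀ u ∈ Ico r t, S.unfinished u = S.unfinished r)
    {u : ℝ} (hu : u ∈ Ico r t) {j : Fin J} (hj : j ∈ S.unfinished r) :
    S.rem j u = I.size j - cumulative (S.rate j) u := by
  have hS := h.hasFiniteWork hP hm
  have h1 := (S.mem_unfinished.1 (hU u hu ▸ hj)).2
  rw [work_lt_iff hS] at h1
  exact max_eq_right (sub_nonneg.2 h1.le)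

theorem rem_le_of_served (hP : IsPowerFunction P) (hm : 1 ≤ m) (h : S.IsSRPT P)
    (hU : ∀ u ∈ Ico r t, S.unfinished u = S.unfinished r)
    {u : ℝ} {i j : Fin J} (hu : u ∈ Ico r t) (hi : i ∈ S.served u)
    (hj : j ∈ S.unfinished r) (hj' : j ∉ S.served u) : S.rem i u ≤ S.rem j u := by
  have hS := h.hasFiniteWork hP hm
  have := h.shortest u i hi j (hU u hu ▸ hj) hj'
  rwa [remaining_eq hS, remaining_eq hS, ENNReal.ofReal_le_ofReal_iff (rem_nonneg _ _)] at this

theorem rate_eq_on (h : S.IsSRPT P)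
    (hU : ∀ u ∈ Ico r t, S.unfinished u = S.unfinished r)
    {u : ℝ} (hu : u ∈ Ico r t) (j : Fin J) : S.rate j u =
    if j ∈ S.served u then ENNReal.ofReal (speedRule P m (S.numUnfinished r)) else 0 := by
  rw [h.rate_eq, numUnfinished, hU u hu, ← numUnfinished]

/-- Up to the first time the gap would close, `i` is strictly shorter, so `i` is served whenever `j`
is. All served jobs run at the same speed, hence the gap cannot shrink. -/
theorem rem_lt_rem (hP : IsPowerFunction P) (hm : 1 ≤ m) (h : S.IsSRPT P)
    (hU : ∀ u ∈ Ico r t, S.unfinished u = S.unfinished r)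
    {a b : ℝ} {i j : Fin J} (hra : r ≤ a) (hab : a ≤ b) (hbt : b < t)
    (hi : i ∈ S.unfinished r) (hj : j ∈ S.unfinished r) (hlt : S.rem i a < S.rem j a) :
    S.rem i b < S.rem j b := by
  have hS := h.hasFiniteWork hP hm
  have hmem : ∀ u ∈ Icc a b, u ∈ Ico r t := fun u hu => ⟨hra.trans hu.1, hu.2.trans_lt hbt⟩
  set D : ℝ → ℝ := fun u => (I.size j - cumulative (S.rate j) u) -
    (I.size i - cumulative (S.rate i) u) with hD
  have hDe : ∀ u ∈ Icc a b, S.rem j u - S.rem i u = D u := fun u hu => by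
    rw [h.rem_eq_sub hP hm hU (hmem u hu) hi, h.rem_eq_sub hP hm hU (hmem u hu) hj]
  have hDc : Continuous D :=
    (continuous_const.sub (continuous_cumulative (S.measurable_rate j) (hS.rate j))).sub
      (continuous_const.sub (continuous_cumulative (S.measurable_rate i) (hS.rate i)))
  by_contra hcon
  set E : Set ℝ := Icc a b ∩ {u | D u ≤ 0} with hE
  have hEc : IsClosed E := isClosed_Icc.inter (isClosed_le hDc continuous_const)
  have hbE : b ∈ E := ⟨right_mem_Icc.2 hab, by
    rw [mem_ofPred_eq, ← hDe b (right_mem_Icc.2 hab)]; linarith [not_lt.1 hcon]⟩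
  have hEb : BddBelow E := ⟨a, fun u hu => hu.1.1⟩
  obtain ⟨hc, hc0⟩ := hEc.csInf_mem ⟨b, hbE⟩ hEb
  set c := sInf E
  have hpos : ∀ u ∈ Ico a c, 0 < D u := fun u hu => by
    by_contra hu0
    exact absurd (csInf_le hEb ⟨⟨hu.1, hu.2.le.trans hc.2⟩, not_lt.1 hu0⟩) (not_le.2 hu.2)
  have hrates : cumulative (S.rate j) c - cumulative (S.rate j) a ≤
      cumulative (S.rate i) c - cumulative (S.rate i) a := by
    rw [cumulative_sub (hS.rate j) hc.1, cumulative_sub (hS.rate i) hc.1]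
    refine ENNReal.toReal_mono (setLIntegral_Ioc_ne_top (hS.rate i) a c) ?_
    rw [setLIntegral_congr Ioo_ae_eq_Ioc.symm, setLIntegral_congr Ioo_ae_eq_Ioc.symm]
    refine setLIntegral_mono' measurableSet_Ioo fun u hu => ?_
    have huab : u ∈ Icc a b := ⟨hu.1.le, hu.2.le.trans hc.2⟩
    rw [h.rate_eq, h.rate_eq]
    by_cases hju : j ∈ S.served u
    · by_cases hiu : i ∈ S.served u
      · rw [if_pos hju, if_pos hiu]
      · have := h.rem_le_of_served hP hm hU (hmem u huab) hju hi hiu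
        linarith [hpos u ⟨hu.1.le, hu.2⟩, hDe u huab]
    · rw [if_neg hju]; exact zero_le
  have hDa := hDe a (left_mem_Icc.2 hab)
  simp only [hD, mem_ofPred_eq] at hc0 hDa
  linarith

/-- Ties between `i` and `j` form a level set of the primitive of the difference of their rates, so
the rates agree at almost every tie. -/
theorem ae_served_iff (hP : IsPowerFunction P) (hm : 1 ≤ m) (h : S.IsSRPT P)
    (hU : ∀ u ∈ Ico r t, S.unfinished u = S.unfinished r)
    : ∀ᵐ u, ∀ i ∈ S.unfinished r, ∀ j ∈ S.unfinished r, u ∈ Ico r t →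
    S.rem i u = S.rem j u → (i ∈ S.served u ↔ j ∈ S.served u) := by
  have hS := h.hasFiniteWork hP hm
  simp_rw [ae_all_iff]
  intro i hi j hj
  have hloc := (locallyIntegrable_toReal (S.measurable_rate i) (hS.rate i)).sub
    (locallyIntegrable_toReal (S.measurable_rate j) (hS.rate j))
  set h0 : ℝ → ℝ := (fun u => (S.rate i u).toReal) - fun u => (S.rate j u).toReal with hh0
  filter_upwards [ae_eq_zero_of_primitive_eq hloc r
    ((I.size i - cumulative (S.rate i) r) - (I.size j - cumulative (S.rate j) r))]
    with u hu hur heq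
  have hint : ∀ k, IntervalIntegrable (fun u => (S.rate k u).toReal) volume r u := fun k =>
    ((locallyIntegrable_toReal (S.measurable_rate k) (hS.rate k)).integrableOn_isCompact
      isCompact_uIcc).intervalIntegrable
  have hprim : ∫ v in r..u, h0 v =
      (I.size i - cumulative (S.rate i) r) - (I.size j - cumulative (S.rate j) r) := by
    rw [hh0]
    simp only [Pi.sub_apply]
    rw [intervalIntegral.integral_sub (hint i) (hint j),
      ← cumulative_sub_eq_integral (S.measurable_rate i) (hS.rate i),
      ← cumulative_sub_eq_integral (S.measurable_rate j) (hS.rate j)]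
    rw [h.rem_eq_sub hP hm hU hur hi, h.rem_eq_sub hP hm hU hur hj] at heq
    linarith
  have hz := hu hprim
  have hsp := speedRule_pos hP hm (S.numUnfinished u)
  simp only [hh0, Pi.sub_apply, h.rate_eq] at hz
  by_cases hi' : i ∈ S.served u <;> by_cases hj' : j ∈ S.served u <;>
    simp only [hi', hj', if_true, if_false, ENNReal.toReal_ofReal hsp.le, ENNReal.toReal_zero,
      iff_true, iff_false] at hz ⊢ <;> first | trivial | linarith

/-- Between arrivals and completions the set of served jobs is constant. -/
theorem exists_served_eq (hP : IsPowerFunction P) (hm : 1 ≤ m) (h : S.IsSRPT P)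
    (hU : ∀ u ∈ Ico r t, S.unfinished u = S.unfinished r)
    (hrt : r < t) : ∃ A, ∀ u ∈ Ioo r t, S.served u = A := by
  -- There are times arbitrarily close to `r` at which tied jobs are either both served or both
  -- unserved.
  have hgen : ∀ v, r < v → ∃ w ∈ Ioo r v, ∀ i ∈ S.unfinished r, ∀ j ∈ S.unfinished r,
      w ∈ Ico r t → S.rem i w = S.rem j w → (i ∈ S.served w ↔ j ∈ S.served w) := fun v hv => by
    have hne : (volume (Ioo r v)) ≠ 0 := by
      rw [Real.volume_Ioo]; simpa using hv
    have := (frequently_ae_mem_iff.2 hne).and_eventually (h.ae_served_iff hP hm hU)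
    exact this.exists
  -- From such a time on the served set is frozen: a job `j` that replaces `i` was strictly longer
  -- at `w`, and by `rem_lt_rem` it still is.
  have hlock : ∀ w ∈ Ioo r t, (∀ i ∈ S.unfinished r, ∀ j ∈ S.unfinished r,
      w ∈ Ico r t → S.rem i w = S.rem j w → (i ∈ S.served w ↔ j ∈ S.served w)) →
      ∀ u ∈ Ico w t, S.served u = S.served w := fun w hw hgw u hu => by
    have hwI : w ∈ Ico r t := ⟨hw.1.le, hw.2⟩
    have huI : u ∈ Ico r t := ⟨hw.1.le.trans hu.1, hu.2⟩
    have hsub : ∀ v ∈ Ico r t, S.served v ⊆ S.unfinished r := fun v hv =>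
      hU v hv ▸ h.served_subset v
    have hcard : (S.served u).card = (S.served w).card := by
      rw [h.card_served, h.card_served, numUnfinished, numUnfinished, hU u huI, hU w hwI]
    refine Finset.eq_of_subset_of_card_le (fun j hj => ?_) hcard.ge
    by_contra hjw
    obtain ⟨i, hiw, hiu⟩ : ∃ i ∈ S.served w, i ∉ S.served u := by
      by_contra hcon
      push Not at hcon
      have := Finset.eq_of_subset_of_card_le (s := S.served w) hcon hcard.le
      exact hjw (this ▸ hj)
    have hi := hsub w hwI hiw
    have hj0 := hsub u huI hj
    have hlt : S.rem i w < S.rem j w :=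
      lt_of_le_of_ne (h.rem_le_of_served hP hm hU hwI hiw hj0 hjw) fun e =>
        hjw ((hgw i hi j hj0 hwI e).1 hiw)
    exact absurd (h.rem_lt_rem hP hm hU hw.1.le hu.1 hu.2 hi hj0 hlt)
      (not_lt.2 (h.rem_le_of_served hP hm hU huI hj hi hiu))
  obtain ⟨w, hw, hgw⟩ := hgen t hrt
  refine ⟨S.served w, fun u hu => ?_⟩
  obtain ⟨v, hv, hgv⟩ := hgen (min u w) (lt_min hu.1 hw.1)
  have hvI : v ∈ Ioo r t := ⟨hv.1, hv.2.trans_le ((min_le_left _ _).trans hu.2.le)⟩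
  rw [hlock v hvI hgv u ⟨hv.2.le.trans (min_le_left _ _), hu.2⟩,
    hlock v hvI hgv w ⟨hv.2.le.trans (min_le_right _ _), hw.2⟩]

/-- The evolution of an SRPT run between two times without arrivals and completions. -/
theorem exists_evolution (hP : IsPowerFunction P) (hm : 1 ≤ m) (h : S.IsSRPT P) {F : Finset ℝ}
    (hF : ∀ j, I.arrival j ∈ F)
    (hF' : ∀ j c, (∀ u, S.work j u < ENNReal.ofReal (I.size j) ↔ u < c) → c ∈ F)
    (hrt : r < t) (hd : Disjoint (F : Set ℝ) (Ioo r t)) :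
    ∃ A ⊆ S.unfinished r, A.card = min m (S.numUnfinished r) ∧
      (∀ i ∈ A, ∀ j ∈ S.unfinished r, j ∉ A → S.rem i r ≤ S.rem j r) ∧
      (∀ i ∈ A, speedRule P m (S.numUnfinished r) * (t - r) ≤ S.rem i r) ∧
      (∀ u ∈ Icc r t, ∀ j, S.rem j u = if j ∈ A then
        S.rem j r - speedRule P m (S.numUnfinished r) * (u - r) else S.rem j r) ∧
      ∀ u ∈ Icc r t, cumulative (fun u => (S.numUnfinished u : ℝ≥0∞)) u =
        cumulative (fun u => (S.numUnfinished u : ℝ≥0∞)) r + S.numUnfinished r * (u - r) := by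
  have hS := h.hasFiniteWork hP hm
  have hU : ∀ u ∈ Ico r t, S.unfinished u = S.unfinished r := fun u hu =>
    unfinished_eq_of_no_events hS hF hF' hd hu
  set s := speedRule P m (S.numUnfinished r) with hs
  have hs0 : 0 < s := speedRule_pos hP hm _
  obtain ⟨A, hA⟩ := h.exists_served_eq hP hm hU hrt
  set w := (r + t) / 2 with hwdef
  have hw : w ∈ Ioo r t := ⟨by linarith, by linarith⟩
  have hw' : w ∈ Ico r t := ⟨hw.1.le, hw.2⟩
  have hAU : A ⊆ S.unfinished r := by
    rw [← hA w hw, ← hU w hw']; exact h.served_subset w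
  have hcum : ∀ u ∈ Icc r t, ∀ j, cumulative (S.rate j) u - cumulative (S.rate j) r =
      if j ∈ A then s * (u - r) else 0 := fun u hu j => by
    rw [cumulative_sub (hS.rate j) hu.1, setLIntegral_congr Ioo_ae_eq_Ioc.symm,
      setLIntegral_congr_fun (g := fun _ => if j ∈ A then ENNReal.ofReal s else 0)
        measurableSet_Ioo fun v hv => ?_]
    · rw [setLIntegral_const, Real.volume_Ioo]
      split_ifs
      · rw [ENNReal.toReal_mul, ENNReal.toReal_ofReal hs0.le,
          ENNReal.toReal_ofReal (sub_nonneg.2 hu.1)]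
      · simp
    · have hv' : v ∈ Ioo r t := ⟨hv.1, hv.2.trans_le hu.2⟩
      simp only [h.rate_eq_on hU ⟨hv'.1.le, hv'.2⟩, hA v hv', hs]
  have hremr : ∀ j ∈ A, S.rem j r = I.size j - cumulative (S.rate j) r := fun j hj =>
    h.rem_eq_sub hP hm hU (left_mem_Ico.2 hrt) (hAU hj)
  have hle : ∀ i ∈ A, s * (t - r) ≤ S.rem i r := fun i hi => by
    have h1 : ∀ u, r < u → u < t → s * (u - r) ≤ S.rem i r := fun u hru hut => by
      have h2 := hcum u ⟨hru.le, hut.le⟩ i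
      rw [if_pos hi] at h2
      have h3 := h.rem_eq_sub hP hm hU ⟨hru.le, hut⟩ (hAU hi)
      rw [hremr i hi]
      linarith [S.rem_nonneg (j := i) (t := u)]
    -- The bound passes to the endpoint by density; at `t` itself the job may be complete.
    have h4 : t - r ≤ S.rem i r / s := by
      rw [sub_le_iff_le_add]
      refine le_of_forall_lt_imp_le_of_dense fun u hu => ?_
      rcases le_or_gt u r with hur | hur
      · exact hur.trans (by linarith [div_nonneg (S.rem_nonneg (j := i) (t := r)) hs0.le])
      · rw [← sub_le_iff_le_add, le_div_iff₀ hs0, mul_comm]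
        exact h1 u hur hu
    rwa [le_div_iff₀ hs0, mul_comm] at h4
  refine ⟨A, hAU, ?_, fun i hi j hj hjA => ?_, hle, fun u hu j => ?_, fun u hu => ?_⟩
  · rw [← hA w hw, h.card_served, numUnfinished, hU w hw', numUnfinished]
  · by_contra hlt
    have h1 := h.rem_lt_rem hP hm hU le_rfl hw.1.le hw.2 hj (hAU hi) (not_le.1 hlt)
    rw [← hA w hw] at hi hjA
    exact absurd (h.rem_le_of_served hP hm hU hw' hi hj hjA) (not_le.2 h1)
  · have h2 := hcum u hu j
    split_ifs at h2 ⊢ with hj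
    · rw [rem, hremr j hj]
      have h3 := hle j hj
      rw [hremr j hj] at h3
      have h4 : s * (u - r) ≤ s * (t - r) := by
        have := hu.2
        gcongr
      rw [max_eq_right (by linarith)]
      linarith
    · rw [rem, rem, sub_eq_zero.1 h2]
  · have hn := S.lintegral_Iic_numUnfinished_ne_top
    have : cumulative (fun u => (S.numUnfinished u : ℝ≥0∞)) u -
        cumulative (fun u => (S.numUnfinished u : ℝ≥0∞)) r = S.numUnfinished r * (u - r) := by
      rw [cumulative_sub hn hu.1, setLIntegral_congr Ioo_ae_eq_Ioc.symm,
        setLIntegral_congr_fun (g := fun _ => (S.numUnfinished r : ℝ≥0∞)) measurableSet_Ioo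
          fun v hv => ?_]
      · rw [setLIntegral_const, Real.volume_Ioo, ENNReal.toReal_mul,
          ENNReal.toReal_ofReal (sub_nonneg.2 hu.1), ENNReal.toReal_natCast]
      · simp only [numUnfinished, hU v ⟨hv.1.le, hv.2.trans_le hu.2⟩]
    linarith

end IsSRPT

end Schedule

/-! ### The amortized inequality -/

/-- A property that is inherited along intervals without events is inherited along all intervals. -/
theorem forall_le_of_no_events {F : Finset ℝ} {p : ℝ → Prop}
    (h : ∀ r t, r < t → Disjoint (F : Set ℝ) (Ioo r t) → p r → p t) {r t : ℝ} (hrt : r ≤ t)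
    (hr : p r) : p t := by
  rcases hrt.eq_or_lt with rfl | hrt
  · exact hr
  induction hk : (F.filter fun c => c ∈ Ioo r t).card using Nat.strong_induction_on
    generalizing r t with
  | _ k ih =>
    subst hk
    by_cases hd : Disjoint (F : Set ℝ) (Ioo r t)
    · exact h r t hrt hd hr
    · obtain ⟨c, hcF, hc⟩ := Set.not_disjoint_iff.1 hd
      have hlt : ∀ {a b : ℝ}, r ≤ a → b ≤ t → c ∉ Ioo a b →
          (F.filter fun x => x ∈ Ioo a b).card < (F.filter fun x => x ∈ Ioo r t).card :=
        fun ha hb hcab => Finset.card_lt_card <| (Finset.ssubset_iff_of_subset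
          (Finset.monotone_filter_right F fun x _ hx => ⟨ha.trans_lt hx.1, hx.2.trans_le hb⟩)).2
          ⟨c, Finset.mem_filter.2 ⟨hcF, hc⟩, fun h => hcab (Finset.mem_filter.1 h).2⟩
      have h1 := ih _ (hlt (b := c) le_rfl hc.2.le fun h => lt_irrefl c h.2) hc.1.le hr hc.1 rfl
      exact ih _ (hlt (a := c) hc.1.le le_rfl fun h => lt_irrefl c h.1) hc.2.le h1 hc.2 rfl

namespace Schedule

variable {J : ℕ} {I : JobSequence J} {m : ℕ} {P : ℝ → ℝ}

/-- The amortized comparison of the schedules `S` and `O` at time `t`, where `z` is the state of a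
single server that runs at the total speed of `O` and processes the shortest job in `R`. -/
structure Amortized (P : ℝ → ℝ) (C σ : ℝ) (g : ℤ → ℝ) (S O : Schedule I m) (R : Finset (Fin J))
    (t : ℝ) (z : Fin J → ℝ) : Prop where
  bounds : ∀ j ∈ R, 0 ≤ z j ∧ z j ≤ ∑ i, I.size i
  dominates : Dominates R z (O.rem · t)
  le : cumulative (fun u => (S.numUnfinished u : ℝ≥0∞)) t + σ * ∑ j, S.rem j t +
      potential g (∑ i, I.size i) R (S.rem · t) z ≤
    C * cumulative (fun u => (O.numUnfinished u : ℝ≥0∞) + O.power P u) t + σ * ∑ i, I.size i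

theorem rem_mem_Icc (S : Schedule I m) (j : Fin J) (t : ℝ) :
    0 ≤ S.rem j t ∧ S.rem j t ≤ ∑ i, I.size i :=
  ⟨rem_nonneg _ _, (rem_le _ _).trans
    (Finset.single_le_sum (fun i _ => (I.size_pos i).le) (Finset.mem_univ j))⟩

section Step

variable {C σ : ℝ} {g : ℤ → ℝ} {S O : Schedule I m} {F : Finset ℝ} {r t : ℝ}

/-- Here the potential drift, the supporting-line bound for `O` and the drift condition are
combined, on `[v, v']` where the virtual server drains only `p` or has nothing to do. The set `R`
stays that of time `r`; jobs arriving at `t` are added in `Amortized.step`. -/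
theorem Amortized.move (hP : IsPowerFunction P) (hm : 1 ≤ m) (hg : IsDriftWeight P m C σ g)
    (hC : 0 ≤ C) (hS : S.IsSRPT P) (hO : O.cost P ≠ ∞) (hF : ∀ j, I.arrival j ∈ F)
    (hF' : ∀ j c, (∀ u, S.work j u < ENNReal.ofReal (I.size j) ↔ u < c) → c ∈ F)
    (hd : Disjoint (F : Set ℝ) (Ioo r t)) {v v' : ℝ} (hrv : r ≤ v) (hvv' : v < v') (hv't : v' ≤ t)
    {z z' : Fin J → ℝ} (hz : Amortized P C σ g S O (I.released r) v z)
    (hz' : (z' = z ∧ ∀ j ∈ I.released r, z j ≤ 0) ∨ ∃ p ∈ I.released r, 0 < z p ∧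
      (∀ j ∈ I.released r, 0 < z j → z p ≤ z j) ∧
      cumulative O.totalSpeed v' - cumulative O.totalSpeed v ≤ z p ∧
      (∀ u ∈ Ioo v v', cumulative O.totalSpeed u - cumulative O.totalSpeed v < z p) ∧
      z' = Function.update z p
        (z p - (cumulative O.totalSpeed v' - cumulative O.totalSpeed v))) :
    Amortized P C σ g S O (I.released r) v' z' := by
  have hSf := hS.hasFiniteWork hP hm
  have hOf := hasFiniteWork_of_cost_ne_top hP hO
  set R := I.released r with hR
  set U := cumulative O.totalSpeed with hUdef
  have hUm : Monotone U := cumulative_mono hOf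
  set e := U v' - U v with he
  have he0 : 0 ≤ e := sub_nonneg.2 (hUm hvv'.le)
  have hrt : r < t := hrv.trans_lt (hvv'.trans_le hv't)
  have hrel : ∀ u ∈ Ico r t, I.released u = R := fun u hu => by
    ext j
    rw [JobSequence.mem_released, JobSequence.mem_released,
      arrival_le_iff_of_no_events hF hd hu]
  have hvI : v ∈ Ico r t := ⟨hrv, hvv'.trans_le hv't⟩
  have hz0 : ∀ j ∈ R, 0 ≤ z j := fun j hj => (hz.bounds j hj).1
  have hzz' : ∀ j ∈ R, 0 ≤ z' j ∧ z' j ≤ z j := fun j hj => by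
    rcases hz' with ⟨rfl, -⟩ | ⟨p, -, -, -, hep, -, rfl⟩
    · exact ⟨hz0 j hj, le_rfl⟩
    · by_cases hjp : j = p
      · subst hjp; rw [Function.update_self]; constructor <;> linarith
      · rw [Function.update_of_ne hjp]; exact ⟨hz0 j hj, le_rfl⟩
  have hdrain : ∀ u, v ≤ u → ∀ p ∈ R, 0 < z p → (∀ j ∈ R, 0 < z j → z p ≤ z j) →
      Dominates R (Function.update z p (z p - (U u - U v))) (O.rem · u) := fun u hu p hp hp0 hmin =>
    hz.dominates.drain hp0 hmin (fun j _ => ⟨rem_nonneg _ _, rem_antitone hOf j hu⟩)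
      (sum_rem_sub_le hOf R hu) hp
  -- Strictly before `v'` the job `p` is not exhausted, so the number of positive virtual entries is
  -- still that of time `v`; dominance at time `u` then applies.
  have hcount : ∀ u ∈ Ioo v v', countAbove R z 0 ≤ O.numUnfinished u := fun u hu => by
    have hu' : u ∈ Ico r t := ⟨hrv.trans hu.1.le, hu.2.trans_le hv't⟩
    rw [← countAbove_rem hOf, hrel u hu']
    rcases hz' with ⟨-, hnp⟩ | ⟨p, hp, hp0, hmin, -, hlt, -⟩
    · have : countAbove R z 0 = 0 := by
        rw [countAbove, Finset.card_eq_zero, Finset.filter_eq_empty_iff]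
        exact fun j hj => not_lt.2 (hnp j hj)
      omega
    · have hlt' := hlt u hu
      have hup := hUm hu.1.le
      refine le_trans (Finset.card_le_card fun j hj => ?_)
        ((hdrain u hu.1.le p hp hp0 hmin).countAbove_le (fun j hj => ?_)
          fun j _ => rem_nonneg _ _)
      · rw [Finset.mem_filter] at hj ⊢
        refine ⟨hj.1, ?_⟩
        by_cases hjp : j = p
        · rw [hjp, Function.update_self]; linarith
        · rw [Function.update_of_ne hjp]; exact hj.2
      · by_cases hjp : j = p
        · rw [hjp, Function.update_self]; linarith
        · rw [Function.update_of_ne hjp]; exact hz0 j hj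
  obtain ⟨A, hAU, hAcard, hAmin, hAle, hrem, hcum⟩ := hS.exists_evolution hP hm hF hF' hrt hd
  set n := S.numUnfinished r with hn
  set s := speedRule P m n with hs
  have hs0 : 0 < s := speedRule_pos hP hm n
  have hvIcc : v ∈ Icc r t := ⟨hvI.1, hvI.2.le⟩
  have hv'Icc : v' ∈ Icc r t := ⟨hrv.trans hvv'.le, hv't⟩
  have hΔ : 0 < v' - v := sub_pos.2 hvv'
  have hstate : (S.rem · v') =
      fun i => if i ∈ A then S.rem i v - s * (v' - v) else S.rem i v := by
    ext i
    simp only [hrem v' hv'Icc i, hrem v hvIcc i]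
    split_ifs <;> ring
  have hdA : ∀ i ∈ A, s * (v' - v) ≤ S.rem i v := fun i hi => by
    have h1 := S.rem_nonneg (j := i) (t := v')
    have h2 := congrFun hstate i
    simp only [if_pos hi] at h2
    linarith
  have hAR : A ⊆ R := fun j hj => JobSequence.mem_released.2 (S.mem_unfinished.1 (hAU hj)).1
  have hcountS : countAbove R (S.rem · v) 0 = n := by
    rw [← hrel v hvI, countAbove_rem hSf, numUnfinished,
      unfinished_eq_of_no_events hSf hF hF' hd hvI, ← numUnfinished]
  obtain ⟨j, hj, hpot⟩ := exists_potential_move_le hg.monotone hg.eq_zero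
    (T := ∑ i, I.size i) (R := R) (A := A) (x := (S.rem · v)) (z := z) (z' := z')
    (d := s * (v' - v)) (fun j _ => S.rem_mem_Icc j v) hz.bounds hAR (by positivity) hdA
    (fun i hi => lt_of_lt_of_le (by positivity) (hdA i hi))
    (fun i hi j hj hjA hj0 => by
      simp only [hrem v hvIcc, if_pos hi, if_neg hjA] at hj0 ⊢
      have := hAmin i hi j (S.mem_unfinished.2
        ⟨JobSequence.mem_released.1 hj, (rem_pos_iff hSf _ _).1 hj0⟩) hjA
      have : 0 ≤ s * (v - r) := mul_nonneg hs0.le (sub_nonneg.2 hrv)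
      linarith)
    (by
      rcases hz' with ⟨h, -⟩ | ⟨p, hp, hp0, hmin, hep, -, h⟩
      · exact Or.inl h
      · exact Or.inr ⟨p, hp, e, hp0, hmin, he0, hep, h⟩)
  rw [hcountS] at hj
  rw [← hstate, hAcard] at hpot
  obtain ⟨μ, hline, hdrift⟩ := hg.drift n (countAbove R z 0) j hj
  have hOcost := le_cumulative_cost_sub hP hO hC (hg.nonneg j) hline hvv'.le hcount
  have hzsum : (∑ j ∈ R, z j - ∑ j ∈ R, z' j) * g j ≤ g j * e := by
    rw [mul_comm]
    refine mul_le_mul_of_nonneg_left ?_ (hg.nonneg j)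
    rcases hz' with ⟨rfl, -⟩ | ⟨p, hp, -, -, -, -, rfl⟩
    · linarith
    · rw [Finset.sum_update_of_mem hp, ← Finset.add_sum_erase _ _ hp,
        Finset.sdiff_singleton_eq_erase]
      linarith
  have hremsum : ∑ j, S.rem j v' = ∑ j, S.rem j v - (min m n : ℕ) * (s * (v' - v)) := by
    have h1 : ∀ i, S.rem i v' = S.rem i v - if i ∈ A then s * (v' - v) else 0 := fun i => by
      refine (congrFun hstate i).trans ?_
      split_ifs <;> ring
    simp_rw [h1]
    rw [Finset.sum_sub_distrib, Finset.sum_ite_mem, Finset.univ_inter, Finset.sum_const,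
      nsmul_eq_mul, hAcard]
  refine ⟨fun j hj => ⟨(hzz' j hj).1, (hzz' j hj).2.trans (hz.bounds j hj).2⟩, ?_, ?_⟩
  · rcases hz' with ⟨rfl, hnp⟩ | ⟨p, hp, hp0, hmin, -, -, rfl⟩
    · exact Dominates.of_nonpos hnp fun j _ => rem_nonneg _ _
    · exact hdrain v' hvv'.le p hp hp0 hmin
  · have hbase := hz.le
    have hc1 := hcum v hvIcc
    have hc2 := hcum v' hv'Icc
    have hdriftΔ := mul_le_mul_of_nonneg_right hdrift hΔ.le
    rw [hremsum, hc2]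
    rw [hc1] at hbase
    nlinarith

/-- Completions in the virtual state are not among the events, so the interval is cut at them, by
induction on the number of positive entries of `z`. -/
theorem Amortized.step_aux (hP : IsPowerFunction P) (hm : 1 ≤ m) (hg : IsDriftWeight P m C σ g)
    (hC : 0 ≤ C) (hS : S.IsSRPT P) (hO : O.cost P ≠ ∞) (hF : ∀ j, I.arrival j ∈ F)
    (hF' : ∀ j c, (∀ u, S.work j u < ENNReal.ofReal (I.size j) ↔ u < c) → c ∈ F)
    (hd : Disjoint (F : Set ℝ) (Ioo r t)) {v : ℝ} (hrv : r ≤ v) (hvt : v ≤ t)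
    {z : Fin J → ℝ} (hz : Amortized P C σ g S O (I.released r) v z) :
    ∃ z', Amortized P C σ g S O (I.released r) t z' := by
  induction hk : countAbove (I.released r) z 0 using Nat.strong_induction_on
    generalizing v z with
  | _ k ih =>
  subst hk
  rcases hvt.eq_or_lt with rfl | hvt
  · exact ⟨z, hz⟩
  have hOf := hasFiniteWork_of_cost_ne_top hP hO
  set U := cumulative O.totalSpeed with hUdef
  have hUc : Continuous U := continuous_cumulative O.measurable_totalSpeed hOf
  by_cases hnp : ∀ j ∈ I.released r, z j ≤ 0
  · exact ⟨z, hz.move hP hm hg hC hS hO hF hF' hd hrv hvt le_rfl (Or.inl ⟨rfl, hnp⟩)⟩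
  push Not at hnp
  obtain ⟨p, hp, hmin⟩ := Finset.exists_min_image ((I.released r).filter fun j => 0 < z j) z
    (by obtain ⟨j, hj, hj0⟩ := hnp; exact ⟨j, Finset.mem_filter.2 ⟨hj, hj0⟩⟩)
  obtain ⟨hpR, hp0⟩ := Finset.mem_filter.1 hp
  have hmin' : ∀ j ∈ I.released r, 0 < z j → z p ≤ z j := fun j hj hj0 =>
    hmin j (Finset.mem_filter.2 ⟨hj, hj0⟩)
  rcases lt_or_ge (U t - U v) (z p) with hlt | hge
  · refine ⟨_, hz.move hP hm hg hC hS hO hF hF' hd hrv hvt le_rfl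
      (Or.inr ⟨p, hpR, hp0, hmin', hlt.le, fun u hu => ?_, rfl⟩)⟩
    have := cumulative_mono hOf hu.2.le
    linarith
  -- Its infimum is the first time at which `p` is exhausted; by continuity exactly `z p` units have
  -- been spent then.
  set E : Set ℝ := Icc v t ∩ {u | z p ≤ U u - U v} with hE
  have hEc : IsClosed E :=
    isClosed_Icc.inter (isClosed_le continuous_const (hUc.sub continuous_const))
  have hEb : BddBelow E := ⟨v, fun u hu => hu.1.1⟩
  obtain ⟨hc, hcz⟩ := hEc.csInf_mem ⟨t, right_mem_Icc.2 hvt.le, hge⟩ hEb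
  set c := sInf E
  rw [mem_ofPred_eq] at hcz
  have hbefore : ∀ u ∈ Ico v c, U u - U v < z p := fun u hu => by
    by_contra h
    exact absurd (csInf_le hEb ⟨⟨hu.1, hu.2.le.trans hc.2⟩, not_lt.1 h⟩) (not_le.2 hu.2)
  have hvc : v < c := by
    rcases hc.1.eq_or_lt with h | h
    · rw [← h] at hcz; linarith
    · exact h
  have hceq : U c - U v = z p := by
    obtain ⟨w, hw, hwz⟩ := intermediate_value_Icc hc.1
      (hUc.sub continuous_const : Continuous fun u => U u - U v).continuousOn
      (show z p ∈ Icc (U v - U v) (U c - U v) from ⟨by linarith, hcz⟩)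
    rcases hw.2.eq_or_lt with rfl | hwc
    · exact hwz
    · exact absurd hwz (hbefore w ⟨hw.1, hwc⟩).ne
  have hmove := hz.move hP hm hg hC hS hO hF hF' hd hrv hvc hc.2
    (Or.inr ⟨p, hpR, hp0, hmin', hceq.le, fun u hu => hbefore u ⟨hu.1.le, hu.2⟩, rfl⟩)
  refine ih _ (Finset.card_lt_card ((Finset.ssubset_iff_of_subset fun j hj => ?_).2
    ⟨p, hp, fun h => ?_⟩)) (hrv.trans hc.1) hc.2 hmove rfl
  · rw [Finset.mem_filter] at hj ⊢
    refine ⟨hj.1, ?_⟩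
    by_cases hjp : j = p
    · rw [hjp]; exact hp0
    · rw [Function.update_of_ne hjp] at hj; exact hj.2
  · rw [Finset.mem_filter, Function.update_self] at h
    linarith [h.2]

theorem Amortized.step (hP : IsPowerFunction P) (hm : 1 ≤ m) (hg : IsDriftWeight P m C σ g)
    (hC : 0 ≤ C) (hS : S.IsSRPT P) (hO : O.cost P ≠ ∞) (hF : ∀ j, I.arrival j ∈ F)
    (hF' : ∀ j c, (∀ u, S.work j u < ENNReal.ofReal (I.size j) ↔ u < c) → c ∈ F)
    (hrt : r < t) (hd : Disjoint (F : Set ℝ) (Ioo r t)) {z : Fin J → ℝ}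
    (hz : Amortized P C σ g S O (I.released r) r z) :
    ∃ z', Amortized P C σ g S O (I.released t) t z' := by
  obtain ⟨z', hz'⟩ := hz.step_aux hP hm hg hC hS hO hF hF' hd le_rfl hrt.le
  have hsub := I.released_mono hrt.le
  have harr : ∀ j ∈ I.released t \ I.released r, t ≤ I.arrival j := fun j hj => by
    rw [Finset.mem_sdiff, JobSequence.mem_released, JobSequence.mem_released] at hj
    by_contra h
    exact Set.disjoint_left.1 hd (hF j) ⟨not_le.1 hj.2, not_le.1 h⟩
  -- Jobs new at `t` enter the virtual state with full size, as they do in `S` and `O`.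
  set z'' : Fin J → ℝ := fun j => if j ∈ I.released r then z' j else I.size j with hz''
  have heq : ∀ j ∈ I.released r, z' j = z'' j := fun j hj => by simp only [hz'', if_pos hj]
  have hnew : ∀ j ∈ I.released t \ I.released r, z'' j = I.size j := fun j hj => by
    simp only [hz'', if_neg (Finset.mem_sdiff.1 hj).2]
  refine ⟨z'', fun j _ => ?_, ?_, ?_⟩
  · simp only [hz'']
    split_ifs with h
    · exact hz'.bounds j h
    · exact ⟨(I.size_pos j).le,
        Finset.single_le_sum (fun i _ => (I.size_pos i).le) (Finset.mem_univ j)⟩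
  · refine (hz'.dominates.congr heq fun _ _ => rfl).of_subset hsub fun j hj => ?_
    rw [hnew j hj, rem_eq_size (harr j hj)]
  · rw [potential_eq_of_subset hsub fun j hj => by rw [hnew j hj, rem_eq_size (harr j hj)],
      potential_congr (fun _ _ => rfl) fun j hj => (heq j hj).symm]
    exact hz'.le

end Step

theorem amortized_empty {C σ : ℝ} (hC : 0 ≤ C) (g : ℤ → ℝ) (S O : Schedule I m) {t : ℝ}
    (ht : ∀ j, t < I.arrival j) : Amortized P C σ g S O (I.released t) t 0 := by
  have hR : I.released t = ∅ := Finset.eq_empty_of_forall_notMem fun j hj =>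
    absurd (JobSequence.mem_released.1 hj) (not_le.2 (ht j))
  refine ⟨by simp [hR], fun B hB => ⟨B, hB, le_rfl, by simp [hR]⟩, ?_⟩
  have h1 : cumulative (fun u => (S.numUnfinished u : ℝ≥0∞)) t = 0 := by
    rw [cumulative, setLIntegral_congr_fun (g := fun _ => 0) measurableSet_Iic fun u hu => by
      simp only [numUnfinished_eq_zero fun j => (mem_Iic.1 hu).trans_lt (ht j), Nat.cast_zero]]
    simp
  have h2 : potential g (∑ i, I.size i) (I.released t) (S.rem · t) 0 = 0 := by
    simp [potential, hR, countAbove, cumWeight]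
  have h3 : ∑ j, S.rem j t = ∑ j, I.size j :=
    Finset.sum_congr rfl fun j _ => rem_eq_size (ht j).le
  rw [h1, h2, h3]
  have := mul_nonneg hC
    (cumulative_nonneg (fun u => (O.numUnfinished u : ℝ≥0∞) + O.power P u) t)
  linarith

/-- The flow time of an SRPT run is at most `C + σ` times the cost of any schedule. -/
theorem IsSRPT.lintegral_numUnfinished_le (hP : IsPowerFunction P) (hm : 1 ≤ m) {C σ : ℝ}
    {g : ℤ → ℝ} (hg : IsDriftWeight P m C σ g) (hC : 0 ≤ C) (hσ : 0 ≤ σ) {S : Schedule I m}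
    (hS : S.IsSRPT P) {O : Schedule I m} (hO : O.cost P ≠ ∞) :
    ∫⁻ t, (S.numUnfinished t : ℝ≥0∞) ≤ ENNReal.ofReal (C + σ) * O.cost P := by
  obtain ⟨t₀, ht₀⟩ := I.exists_lt_arrival
  obtain ⟨F, hF, hF'⟩ := S.exists_events
  have hIic : ∀ t, ∫⁻ u in Iic t, (S.numUnfinished u : ℝ≥0∞) ≤
      ENNReal.ofReal (C + σ) * O.cost P := fun t => by
    have hlarge : ∫⁻ u in Iic (max t₀ t), (S.numUnfinished u : ℝ≥0∞) ≤
        ENNReal.ofReal (C + σ) * O.cost P := by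
      obtain ⟨z, hz⟩ := forall_le_of_no_events
        (p := fun t => ∃ z, Amortized P C σ g S O (I.released t) t z)
        (fun r t hrt hd ⟨z, hz⟩ => hz.step hP hm hg hC hS hO hF hF' hrt hd)
        (le_max_left t₀ t) ⟨0, amortized_empty hC g S O ht₀⟩
      have hle := hz.le
      have h1 := potential_nonneg hg.monotone hg.eq_zero (∑ i, I.size i)
        (I.released (max t₀ t)) (S.rem · (max t₀ t)) z
      have h2 : 0 ≤ σ * ∑ j, S.rem j (max t₀ t) :=
        mul_nonneg hσ (Finset.sum_nonneg fun j _ => rem_nonneg _ _)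
      have h0 := cumulative_nonneg (fun u => (O.numUnfinished u : ℝ≥0∞) + O.power P u) (max t₀ t)
      have hsize : 0 ≤ ∑ i, I.size i := Finset.sum_nonneg fun i _ => (I.size_pos i).le
      rw [← ofReal_cumulative S.lintegral_Iic_numUnfinished_ne_top]
      calc _ ≤ ENNReal.ofReal (C * cumulative
              (fun u => (O.numUnfinished u : ℝ≥0∞) + O.power P u) (max t₀ t) +
              σ * ∑ i, I.size i) := ENNReal.ofReal_le_ofReal (by linarith)
        _ = ENNReal.ofReal C * ENNReal.ofReal (cumulative
              (fun u => (O.numUnfinished u : ℝ≥0∞) + O.power P u) (max t₀ t)) +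
              ENNReal.ofReal σ * ENNReal.ofReal (∑ i, I.size i) := by
          rw [ENNReal.ofReal_add (mul_nonneg hC h0) (mul_nonneg hσ hsize), ENNReal.ofReal_mul hC,
            ENNReal.ofReal_mul hσ]
        _ ≤ ENNReal.ofReal C * O.cost P + ENNReal.ofReal σ * O.cost P := by
          gcongr
          · rw [ofReal_cumulative (lintegral_Iic_cost_ne_top hO), Schedule.cost_eq]
            exact setLIntegral_le_lintegral _ _
          · exact sum_size_le_cost hP O
        _ = _ := by rw [← add_mul, ENNReal.ofReal_add hC hσ]
    exact (lintegral_mono_set (Iic_subset_Iic.2 (le_max_right _ _))).trans hlarge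
  exact le_of_tendsto' ((aecover_Iic (μ := volume) Filter.tendsto_id).lintegral_tendsto_of_countably_generated
    S.measurable_numUnfinished.aemeasurable) hIic

theorem IsSRPT.cost_le (hP : IsPowerFunction P) (hm : 1 ≤ m) {S : Schedule I m}
    (hS : S.IsSRPT P) : S.cost P ≤ ENNReal.ofReal (srptRatio P m) * optCost P m I := by
  obtain ⟨C, σ, g, hC, hσ, hle, hg⟩ := exists_isDriftWeight hP hm
  have hpos : 0 < srptRatio P m := by linarith
  rw [optCost, ENNReal.mul_iInf_of_ne (by simpa using hpos) ENNReal.ofReal_ne_top]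
  refine le_iInf fun O => ?_
  by_cases hO : O.cost P = ∞
  · rw [hO, ENNReal.mul_top (by simpa using hpos)]; exact le_top
  rw [hS.cost_eq hP hm]
  calc 2 * ∫⁻ t, (S.numUnfinished t : ℝ≥0∞)
      ≤ 2 * (ENNReal.ofReal (C + σ) * O.cost P) := by
        gcongr; exact hS.lintegral_numUnfinished_le hP hm hg hC.le hσ hO
    _ = ENNReal.ofReal (2 * (C + σ)) * O.cost P := by
        rw [← mul_assoc, ENNReal.ofReal_mul zero_le_two]; simp
    _ ≤ _ := by gcongr

end Schedule

/-! ### Existence of an SRPT run -/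

theorem Finset.exists_subset_card_eq_forall_le {ι : Type*} [DecidableEq ι] (x : ι → ℝ)
    (U : Finset ι) {k : ℕ} (hk : k ≤ U.card) :
    ∃ A ⊆ U, A.card = k ∧ ∀ i ∈ A, ∀ j ∈ U, j ∉ A → x i ≤ x j := by
  induction k with
  | zero => exact ⟨∅, Finset.empty_subset _, rfl, by simp⟩
  | succ k ih =>
    obtain ⟨A, hAU, hA, hmin⟩ := ih (by omega)
    have hne : (U \ A).Nonempty := by
      rw [← Finset.card_pos, Finset.card_sdiff_of_subset hAU]; omega
    obtain ⟨p, hp, hpmin⟩ := Finset.exists_min_image (U \ A) x hne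
    rw [Finset.mem_sdiff] at hp
    refine ⟨insert p A, Finset.insert_subset hp.1 hAU, by
      rw [Finset.card_insert_of_notMem hp.2, hA], fun i hi j hj hjA => ?_⟩
    rw [Finset.mem_insert, not_or] at hjA
    rcases Finset.mem_insert.1 hi with rfl | hi
    · exact hpmin j (Finset.mem_sdiff.2 ⟨hj, hjA.2⟩)
    · exact hmin i hi j hj hjA.2

theorem Finset.exists_assignment {ι : Type*} (A : Finset ι) {m : ℕ} (hA : A.card ≤ m) :
    ∃ c : Fin m → Option ι, (∀ k k' j, c k = some j → c k' = some j → k = k') ∧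
      ∀ j, (∃ k, c k = some j) ↔ j ∈ A := by
  let e := A.equivFin
  refine ⟨fun k => if h : (k : ℕ) < A.card then some (e.symm ⟨k, h⟩ : ι) else none,
    fun k k' j hk hk' => ?_, fun j => ⟨?_, fun hj => ?_⟩⟩
  · simp only at hk hk'
    split_ifs at hk hk' with h h'
    have : (e.symm ⟨k, h⟩ : ι) = e.symm ⟨k', h'⟩ :=
      (Option.some.inj hk).trans (Option.some.inj hk').symm
    have := e.symm.injective (Subtype.ext this)
    exact Fin.ext (by simpa using this)
  · rintro ⟨k, hk⟩
    simp only at hk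
    split_ifs at hk with h
    rw [← Option.some.inj hk]
    exact (e.symm ⟨k, h⟩).2
  · refine ⟨⟨e ⟨j, hj⟩, (e ⟨j, hj⟩).2.trans_le hA⟩, ?_⟩
    simp

/-- The servers with assignment `c` and speeds `v` follow SRPT, given the unfinished jobs `U`
with remaining sizes `x`. -/
structure IsSRPTConfig (P : ℝ → ℝ) {J m : ℕ} (U : Finset (Fin J)) (x : Fin J → ℝ)
    (c : Fin m → Option (Fin J)) (v : Fin m → ℝ) : Prop where
  mem : ∀ k j, c k = some j → j ∈ U
  no_split : ∀ k k' j, c k = some j → c k' = some j → k = k'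
  card_eq : (Finset.univ.filter fun j => ∃ k, c k = some j).card = min m U.card
  shortest : ∀ i j, (∃ k, c k = some i) → j ∈ U → (¬ ∃ k, c k = some j) → x i ≤ x j
  speed_eq : ∀ k, v k = if c k = none then 0 else speedRule P m U.card

theorem IsSRPTConfig.rate_eq {P : ℝ → ℝ} {J m : ℕ} {U : Finset (Fin J)} {x : Fin J → ℝ}
    {c : Fin m → Option (Fin J)} {v : Fin m → ℝ} (h : IsSRPTConfig P U x c v) (j : Fin J)
    [Decidable (∃ k, c k = some j)] :
    (∑ k, if c k = some j then ENNReal.ofReal (v k) else 0) =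
      if ∃ k, c k = some j then ENNReal.ofReal (speedRule P m U.card) else 0 := by
  split_ifs with hj
  · obtain ⟨k, hk⟩ := hj
    rw [Finset.sum_eq_single k (fun k' _ hne => if_neg fun h' => hne
      (h.no_split k' k j h' hk)) (fun h => absurd (Finset.mem_univ k) h), if_pos hk,
      h.speed_eq k, if_neg (by rw [hk]; simp)]
  · exact Finset.sum_eq_zero fun k _ => if_neg fun hk => hj ⟨k, hk⟩

theorem exists_isSRPTConfig (P : ℝ → ℝ) {J : ℕ} (m : ℕ) (U : Finset (Fin J)) (x : Fin J → ℝ) :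
    ∃ (c : Fin m → Option (Fin J)) (v : Fin m → ℝ), IsSRPTConfig P U x c v := by
  obtain ⟨A, hAU, hA, hmin⟩ :=
    Finset.exists_subset_card_eq_forall_le x U (min_le_right m U.card)
  obtain ⟨c, hc, hcA⟩ := A.exists_assignment (hA.trans_le (min_le_left _ _))
  refine ⟨c, fun k => if c k = none then 0 else speedRule P m U.card,
    fun k j hk => hAU ((hcA j).1 ⟨k, hk⟩), hc, ?_, fun i j hi hj hj' => ?_, fun k => rfl⟩
  · rw [← hA]
    congr 1
    ext j
    simp [hcA]
  · rw [hcA] at hi hj'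
    exact hmin i hi j hj hj'

/-- The released jobs with positive remaining size. -/
noncomputable def JobSequence.alive {J : ℕ} (I : JobSequence J) (x : Fin J → ℝ) (t : ℝ) :
    Finset (Fin J) :=
  Finset.univ.filter fun j => I.arrival j ≤ t ∧ 0 < x j

/-- A run of SRPT on `[t₀, ∞)` that starts with remaining sizes `w`. -/
structure SRPTRunFrom (P : ℝ → ℝ) {J : ℕ} (I : JobSequence J) (m : ℕ) (t₀ : ℝ)
    (w : Fin J → ℝ) where
  job : Fin m → ℝ → Option (Fin J)
  speed : Fin m → ℝ → ℝ
  rem : Fin J → ℝ → ℝ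
  measurableSet_job : ∀ k j, MeasurableSet {t : ℝ | job k t = some j}
  measurable_speed : ∀ k, Measurable (speed k)
  config : ∀ t, t₀ ≤ t →
    IsSRPTConfig P (I.alive (rem · t) t) (rem · t) (job · t) (speed · t)
  rem_nonneg : ∀ j t, t₀ ≤ t → 0 ≤ rem j t
  rem_le : ∀ j t, t₀ ≤ t → rem j t ≤ w j
  work_eq : ∀ j t, t₀ ≤ t →
    ∫⁻ u in Ioc t₀ t, (∑ k, if job k u = some j then ENNReal.ofReal (speed k u) else 0) =
      ENNReal.ofReal (w j - rem j t)

section Existence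

variable {P : ℝ → ℝ} {J : ℕ} {I : JobSequence J} {m : ℕ}

/-- The run that processes the jobs in a fixed configuration until `t₁`, and then continues. -/
theorem SRPTRunFrom.nonempty_glue (hP : IsPowerFunction P) (hm : 1 ≤ m) {t₀ t₁ : ℝ}
    {w : Fin J → ℝ} {c : Fin m → Option (Fin J)} {v : Fin m → ℝ} (h01 : t₀ < t₁)
    (hw : ∀ j, 0 ≤ w j) (hc : IsSRPTConfig P (I.alive w t₀) w c v)
    (harr : ∀ j, t₀ < I.arrival j → t₁ ≤ I.arrival j)
    (hend : ∀ j, (∃ k, c k = some j) → speedRule P m (I.alive w t₀).card * (t₁ - t₀) ≤ w j)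
    {w' : Fin J → ℝ} (hw' : ∀ j, ((∃ k, c k = some j) →
        w' j = w j - speedRule P m (I.alive w t₀).card * (t₁ - t₀)) ∧
      ((¬ ∃ k, c k = some j) → w' j = w j))
    (R : SRPTRunFrom P I m t₁ w') : Nonempty (SRPTRunFrom P I m t₀ w) := by
  classical
  set s := speedRule P m (I.alive w t₀).card with hs
  have hs0 : 0 < s := speedRule_pos hP hm _
  let x : Fin J → ℝ → ℝ := fun j t => if ∃ k, c k = some j then w j - s * (t - t₀) else w j
  have hx0 : ∀ j t, t₀ ≤ t → t ≤ t₁ → 0 ≤ x j t ∧ x j t ≤ w j := fun j t ht ht1 => by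
    simp only [x]
    split_ifs with hj
    · have h1 := hend j hj
      have h2 : s * (t - t₀) ≤ s * (t₁ - t₀) := by gcongr
      have h3 : 0 ≤ s * (t - t₀) := mul_nonneg hs0.le (sub_nonneg.2 ht)
      constructor <;> linarith
    · exact ⟨hw j, le_rfl⟩
  have hxw' : ∀ j, x j t₁ = w' j := fun j => by
    simp only [x]
    split_ifs with hj
    · exact ((hw' j).1 hj).symm
    · exact ((hw' j).2 hj).symm
  have halive : ∀ t, t₀ ≤ t → t < t₁ → I.alive (x · t) t = I.alive w t₀ := fun t ht ht1 => by
    ext j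
    simp only [JobSequence.alive, Finset.mem_filter, Finset.mem_univ, true_and]
    have ha : I.arrival j ≤ t ↔ I.arrival j ≤ t₀ := by
      refine ⟨fun h => ?_, fun h => h.trans ht⟩
      by_contra h'
      linarith [harr j (not_le.1 h')]
    have hp : 0 < x j t ↔ 0 < w j := by
      refine ⟨fun h => h.trans_le (hx0 j t ht ht1.le).2, fun h => ?_⟩
      simp only [x]
      split_ifs with hj
      · have h1 := hend j hj
        have h2 : s * (t - t₀) < s * (t₁ - t₀) := by gcongr
        linarith
      · exact h
    rw [ha, hp]
  have hconst : ∀ j t, t₀ ≤ t → t ≤ t₁ → ∫⁻ _ in Ioo t₀ t,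
      (∑ k, if c k = some j then ENNReal.ofReal (v k) else 0) = ENNReal.ofReal (w j - x j t) :=
    fun j t ht ht1 => by
      rw [setLIntegral_const, hc.rate_eq, Real.volume_Ioo]
      simp only [x]
      split_ifs with hj
      · rw [← ENNReal.ofReal_mul hs0.le]; congr 1; ring
      · simp
  refine ⟨{
    job := fun k t => if t < t₁ then c k else R.job k t
    speed := fun k t => if t < t₁ then v k else R.speed k t
    rem := fun j t => if t < t₁ then x j t else R.rem j t
    measurableSet_job := fun k j => ?_
    measurable_speed := fun k =>
      Measurable.ite measurableSet_Iio measurable_const (R.measurable_speed k)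
    config := fun t ht => ?_
    rem_nonneg := fun j t ht => ?_
    rem_le := fun j t ht => ?_
    work_eq := fun j t ht => ?_ }⟩
  · have : {t | (if t < t₁ then c k else R.job k t) = some j} =
        (Iio t₁ ∩ {_t | c k = some j}) ∪ (Ici t₁ ∩ {t | R.job k t = some j}) := by
      ext t
      by_cases h : t < t₁
      · simp [h, not_le.2 h]
      · simp [h, not_lt.1 h]
    rw [this]
    exact (measurableSet_Iio.inter (MeasurableSet.const _)).union
      (measurableSet_Ici.inter (R.measurableSet_job k j))
  · by_cases h : t < t₁
    · simp only [h, if_true]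
      rw [halive t ht h]
      refine ⟨hc.mem, hc.no_split, hc.card_eq, fun i j hi hj hj' => ?_, hc.speed_eq⟩
      have := hc.shortest i j hi hj hj'
      simp only [x, if_pos hi, if_neg hj']
      have h3 : 0 ≤ s * (t - t₀) := mul_nonneg hs0.le (sub_nonneg.2 ht)
      linarith
    · simp only [h, if_false]
      exact R.config t (not_lt.1 h)
  · split_ifs with h
    · exact (hx0 j t ht h.le).1
    · exact R.rem_nonneg j t (not_lt.1 h)
  · split_ifs with h
    · exact (hx0 j t ht h.le).2
    · refine (R.rem_le j t (not_lt.1 h)).trans ?_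
      rw [← hxw']
      exact (hx0 j t₁ h01.le le_rfl).2
  · have hfirst : ∀ t, t₀ ≤ t → t ≤ t₁ → ∫⁻ u in Ioc t₀ t,
        (∑ k, if (if u < t₁ then c k else R.job k u) = some j then
          ENNReal.ofReal (if u < t₁ then v k else R.speed k u) else 0) =
        ENNReal.ofReal (w j - x j t) := fun t ht ht1 => by
      rw [← hconst j t ht ht1, setLIntegral_congr Ioo_ae_eq_Ioc.symm]
      refine setLIntegral_congr_fun measurableSet_Ioo fun u hu => ?_
      simp only [if_pos (hu.2.trans_le ht1)]
    by_cases h : t < t₁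
    · simp only [if_pos h]
      exact hfirst t ht h.le
    · have h1 := not_lt.1 h
      simp only [if_neg h]
      rw [← Ioc_union_Ioc_eq_Ioc h01.le h1, lintegral_union measurableSet_Ioc
        (Ioc_disjoint_Ioc_of_le le_rfl), hfirst t₁ h01.le le_rfl,
        setLIntegral_congr_fun (g := fun u => ∑ k, if R.job k u = some j then
          ENNReal.ofReal (R.speed k u) else 0) measurableSet_Ioc fun u hu => by
            simp only [if_neg (not_lt.2 hu.1.le)], R.work_eq j t h1, hxw',
        ← ENNReal.ofReal_add]
      · congr 1; ring
      · rw [← hxw']; linarith [(hx0 j t₁ h01.le le_rfl).2]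
      · linarith [R.rem_le j t h1]

/-- Keep one configuration until the next arrival or completion `t₁`, then recurse. The number of
future arrivals plus the number of positive remaining sizes drops at `t₁`. -/
theorem SRPTRunFrom.nonempty (hP : IsPowerFunction P) (hm : 1 ≤ m) (I : JobSequence J) (t₀ : ℝ)
    (w : Fin J → ℝ) (hw : ∀ j, 0 ≤ w j) : Nonempty (SRPTRunFrom P I m t₀ w) := by
  classical
  induction hN : (Finset.univ.filter fun j => t₀ < I.arrival j).card +
      (Finset.univ.filter fun j => 0 < w j).card using Nat.strong_induction_on
    generalizing t₀ w with
  | _ N ih =>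
  subst hN
  obtain ⟨c, v, hc⟩ := exists_isSRPTConfig P m (I.alive w t₀) w
  set s := speedRule P m (I.alive w t₀).card with hs
  have hs0 : 0 < s := speedRule_pos hP hm _
  set E : Finset ℝ := (Finset.univ.filter fun j => t₀ < I.arrival j).image I.arrival ∪
    (Finset.univ.filter fun j => ∃ k, c k = some j).image fun j => t₀ + w j / s with hE
  have hpos : ∀ j, (∃ k, c k = some j) → 0 < w j := fun j ⟨k, hk⟩ =>
    (Finset.mem_filter.1 (hc.mem k j hk)).2.2
  -- With no future event nothing is being served, and the idle configuration is kept forever.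
  rcases E.eq_empty_or_nonempty with hE0 | hE0
  · rw [hE, Finset.union_eq_empty, Finset.image_eq_empty, Finset.image_eq_empty,
      Finset.filter_eq_empty_iff, Finset.filter_eq_empty_iff] at hE0
    have hidle : ∀ k j, c k ≠ some j := fun k j hk => hE0.2 (Finset.mem_univ j) ⟨k, hk⟩
    have halive : ∀ t, t₀ ≤ t → I.alive w t = I.alive w t₀ := fun t ht => by
      ext j
      simp only [JobSequence.alive, Finset.mem_filter, Finset.mem_univ, true_and]
      have := not_lt.1 (hE0.1 (Finset.mem_univ j))
      simp [this, this.trans ht]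
    exact ⟨{
      job := fun k _ => c k
      speed := fun k _ => v k
      rem := fun j _ => w j
      measurableSet_job := fun k j => MeasurableSet.const _
      measurable_speed := fun k => measurable_const
      config := fun t ht => by rw [halive t ht]; exact hc
      rem_nonneg := fun j _ _ => hw j
      rem_le := fun j _ _ => le_rfl
      work_eq := fun j t _ => by simp [hidle] }⟩
  obtain ⟨t₁, ht₁, hmin⟩ := E.exists_min_image id hE0
  simp only [id] at hmin
  have harr : ∀ j, t₀ < I.arrival j → t₁ ≤ I.arrival j := fun j hj =>
    hmin _ (Finset.mem_union_left _ (Finset.mem_image_of_mem _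
      (Finset.mem_filter.2 ⟨Finset.mem_univ j, hj⟩)))
  have hend : ∀ j, (∃ k, c k = some j) → s * (t₁ - t₀) ≤ w j := fun j hj => by
    have h := hmin _ (Finset.mem_union_right _ (Finset.mem_image_of_mem (fun j => t₀ + w j / s)
      (Finset.mem_filter.2 ⟨Finset.mem_univ j, hj⟩)))
    rw [← sub_le_iff_le_add', le_div_iff₀ hs0] at h
    linarith
  have h01 : t₀ < t₁ := by
    rcases Finset.mem_union.1 ht₁ with h | h
    · obtain ⟨j, hj, rfl⟩ := Finset.mem_image.1 h
      exact (Finset.mem_filter.1 hj).2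
    · obtain ⟨j, hj, rfl⟩ := Finset.mem_image.1 h
      have := hpos j (Finset.mem_filter.1 hj).2
      have := div_pos this hs0
      linarith
  set w' : Fin J → ℝ := fun j => if ∃ k, c k = some j then w j - s * (t₁ - t₀) else w j with hw'
  have hw'0 : ∀ j, 0 ≤ w' j ∧ w' j ≤ w j := fun j => by
    simp only [hw']
    split_ifs with hj
    · have := hend j hj
      have : 0 ≤ s * (t₁ - t₀) := mul_nonneg hs0.le (sub_nonneg.2 h01.le)
      constructor <;> linarith
    · exact ⟨hw j, le_rfl⟩
  have hsub1 : (Finset.univ.filter fun j => t₁ < I.arrival j) ⊆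
      Finset.univ.filter fun j => t₀ < I.arrival j :=
    Finset.monotone_filter_right _ fun _ _ h => h01.trans h
  have hsub2 : (Finset.univ.filter fun j => 0 < w' j) ⊆ Finset.univ.filter fun j => 0 < w j :=
    Finset.monotone_filter_right _ fun j _ h => h.trans_le (hw'0 j).2
  have hdec : (Finset.univ.filter fun j => t₁ < I.arrival j).card +
      (Finset.univ.filter fun j => 0 < w' j).card <
      (Finset.univ.filter fun j => t₀ < I.arrival j).card +
      (Finset.univ.filter fun j => 0 < w j).card := by
    rcases Finset.mem_union.1 ht₁ with h | h
    · obtain ⟨j, hj, hjt⟩ := Finset.mem_image.1 h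
      refine add_lt_add_of_lt_of_le (Finset.card_lt_card
        ((Finset.ssubset_iff_of_subset hsub1).2 ⟨j, hj, fun h => ?_⟩)) (Finset.card_le_card hsub2)
      exact absurd (Finset.mem_filter.1 h).2 (by rw [hjt]; exact lt_irrefl _)
    · obtain ⟨j, hj, hjt⟩ := Finset.mem_image.1 h
      have hj' := (Finset.mem_filter.1 hj).2
      refine add_lt_add_of_le_of_lt (Finset.card_le_card hsub1) (Finset.card_lt_card
        ((Finset.ssubset_iff_of_subset hsub2).2
          ⟨j, Finset.mem_filter.2 ⟨Finset.mem_univ j, hpos j hj'⟩, fun h => ?_⟩))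
      have h0 := (Finset.mem_filter.1 h).2
      simp only [hw', if_pos hj', ← hjt, add_sub_cancel_left] at h0
      rw [mul_div_cancel₀ _ hs0.ne', sub_self] at h0
      exact lt_irrefl _ h0
  obtain ⟨R⟩ := ih _ hdec t₁ w' (fun j => (hw'0 j).1) rfl
  exact SRPTRunFrom.nonempty_glue hP hm h01 hw hc harr hend
    (fun j => ⟨fun h => if_pos h, fun h => if_neg h⟩) R

theorem Schedule.exists_isSRPT (hP : IsPowerFunction P) (hm : 1 ≤ m) (I : JobSequence J) :
    ∃ S : Schedule I m, S.IsSRPT P := by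
  obtain ⟨t₀, ht₀⟩ := I.exists_lt_arrival
  obtain ⟨R⟩ := SRPTRunFrom.nonempty hP hm I t₀ I.size fun j => (I.size_pos j).le
  let S : Schedule I m :=
    { job := fun k t => if t₀ ≤ t then R.job k t else none
      speed := fun k t => if t₀ ≤ t then R.speed k t else 0
      measurableSet_job := fun k j => by
        have : {t | (if t₀ ≤ t then R.job k t else none) = some j} =
            Ici t₀ ∩ {t | R.job k t = some j} := by
          ext t
          by_cases h : t₀ ≤ t <;> simp [h]
        rw [this]
        exact measurableSet_Ici.inter (R.measurableSet_job k j)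
      measurable_speed := fun k =>
        Measurable.ite measurableSet_Ici (R.measurable_speed k) measurable_const
      speed_nonneg := fun k t => by
        split_ifs with h
        · rw [(R.config t h).speed_eq k]
          split_ifs
          · exact le_rfl
          · exact (speedRule_pos hP hm _).le
        · exact le_rfl
      speed_idle := fun k t hk => by
        split_ifs at hk ⊢ with h
        · rw [(R.config t h).speed_eq k, if_pos hk]
        · rfl
      released := fun k t j hk => by
        split_ifs at hk with h
        exact (Finset.mem_filter.1 ((R.config t h).mem k j hk)).2.1
      no_split := fun k k' t j hk hk' => by
        split_ifs at hk hk' with h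
        exact (R.config t h).no_split k k' j hk hk' }
  have hjob : ∀ k t, t₀ ≤ t → S.job k t = R.job k t := fun k t ht => if_pos ht
  have hspeed : ∀ k t, t₀ ≤ t → S.speed k t = R.speed k t := fun k t ht => if_pos ht
  have hwork : ∀ j t, t₀ ≤ t → S.work j t = ENNReal.ofReal (I.size j - R.rem j t) :=
    fun j t ht => by
      rw [← R.work_eq j t ht, Schedule.work_eq, setLIntegral_Iic_add_Ioc _ ht, ← Schedule.work_eq,
        S.work_eq_zero (ht₀ j).le, zero_add]
      refine setLIntegral_congr_fun measurableSet_Ioc fun u hu => ?_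
      simp only [Schedule.rate, hjob _ u hu.1.le, hspeed _ u hu.1.le]
  have hunf : ∀ t, t₀ ≤ t → S.unfinished t = I.alive (R.rem · t) t := fun t ht => by
    ext j
    rw [Schedule.mem_unfinished, hwork j t ht, ENNReal.ofReal_lt_ofReal_iff (I.size_pos j)]
    simp [JobSequence.alive]
  have hunf' : ∀ t, t < t₀ → S.numUnfinished t = 0 := fun t ht =>
    Schedule.numUnfinished_eq_zero fun j => ht.trans (ht₀ j)
  have hserved' : ∀ t, t < t₀ → S.served t = ∅ := fun t ht =>
    Finset.eq_empty_of_forall_notMem fun j hj => by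
      obtain ⟨k, hk⟩ := S.mem_served.1 hj
      simp [S, not_le.2 ht] at hk
  have hserved : ∀ t, t₀ ≤ t → ∀ j, j ∈ S.served t ↔ ∃ k, R.job k t = some j := fun t ht j => by
    rw [Schedule.mem_served]
    simp only [hjob _ t ht]
  have hrem : ∀ j t, t₀ ≤ t → S.remaining j t = ENNReal.ofReal (R.rem j t) := fun j t ht => by
    rw [Schedule.remaining, hwork j t ht,
      ← ENNReal.ofReal_sub _ (sub_nonneg.2 (R.rem_le j t ht)), sub_sub_cancel]
  refine ⟨S, fun t j hj => ?_, fun t => ?_, fun t i hi j hj hj' => ?_, fun t k hk => ?_⟩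
  · rcases lt_or_ge t t₀ with h | h
    · rw [hserved' t h] at hj; simp at hj
    · obtain ⟨k, hk⟩ := (hserved t h j).1 hj
      rw [hunf t h]
      exact (R.config t h).mem k j hk
  · rcases lt_or_ge t t₀ with h | h
    · rw [hserved' t h, hunf' t h]; simp
    · rw [Schedule.numUnfinished, hunf t h, ← (R.config t h).card_eq]
      congr 1
      ext j
      simp [hserved t h]
  · rcases lt_or_ge t t₀ with h | h
    · rw [hserved' t h] at hi; simp at hi
    · rw [hrem i t h, hrem j t h]
      rw [hserved t h] at hi hj'
      rw [hunf t h] at hj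
      exact ENNReal.ofReal_le_ofReal ((R.config t h).shortest i j hi hj hj')
  · rcases lt_or_ge t t₀ with h | h
    · exact absurd (if_neg (not_le.2 h)) hk
    · rw [hjob k t h] at hk
      rw [hspeed k t h, (R.config t h).speed_eq k, if_neg hk, Schedule.numUnfinished, hunf t h]

end Existence

/-! ### Power laws and the final statement -/

theorem isPowerFunction_rpow {α : ℝ} (hα : 1 < α) : IsPowerFunction fun s : ℝ => s ^ α where
  map_zero := Real.zero_rpow (by linarith)
  differentiableOn := fun _ _ =>
    (Real.hasDerivAt_rpow_const (Or.inr hα.le)).differentiableAt.differentiableWithinAt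
  strictMonoOn := Real.strictMonoOn_rpow_Ici_of_exponent_pos (by linarith)
  strictConvexOn := strictConvexOn_rpow hα
  submultiplicative := fun _ _ hx hy => (Real.mul_rpow hx.le hy.le).le

theorem srptRatio_rpow {α : ℝ} (hα : 1 < α) (m : ℕ) :
    srptRatio (fun s : ℝ => s ^ α) m = 4 * (2 - 1 / (m : ℝ)) ^ α := by
  have hP := isPowerFunction_rpow hα
  have h1 : powerInv (fun s : ℝ => s ^ α) 1 = 1 :=
    hP.bijOn.injOn (hP.powerInv_nonneg zero_le_one) (mem_Ici.2 zero_le_one)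
      ((hP.map_powerInv zero_le_one).trans (Real.one_rpow α).symm)
  have hset : superlinearSpeeds (fun s : ℝ => s ^ α) = Ioi 1 := by
    ext s
    simp only [superlinearSpeeds, mem_ofPred_eq, mem_Ioi]
    refine ⟨fun ⟨h0, h⟩ => ?_, fun h => ⟨by linarith, Real.self_lt_rpow_of_one_lt h hα⟩⟩
    by_contra hs
    exact absurd h (not_lt.2 (Real.rpow_le_self_of_le_one h0.le (not_lt.1 hs) hα.le))
  have h2 : sBar (fun s : ℝ => s ^ α) = 1 := by rw [sBar, hset, csInf_Ioi]
  rw [srptRatio, h1, h2, Real.one_rpow, max_self]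
  ring

theorem srptIsCompetitive {P : ℝ → ℝ} (hP : IsPowerFunction P) {m : ℕ} (hm : 1 ≤ m) :
    SRPTIsCompetitive P m (srptRatio P m) := fun _ I =>
  ⟨Schedule.exists_isSRPT hP hm I, fun _ hS => hS.cost_le hP hm⟩

theorem mainTheorem1 (m : ℕ) (hm : 1 ≤ m) :
    (∀ P : ℝ → ℝ, IsPowerFunction P →
      Set.BijOn P (Set.Ici 0) (Set.Ici 0) ∧ (superlinearSpeeds P).Nonempty ∧
        SRPTIsCompetitive P m (srptRatio P m)) ∧
    (∀ α : ℝ, 1 < α →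
      srptRatio (fun s : ℝ => s ^ α) m = 4 * (2 - 1 / (m : ℝ)) ^ α ∧
        SRPTIsCompetitive (fun s : ℝ => s ^ α) m (4 * (2 - 1 / (m : ℝ)) ^ α)) := by
  refine ⟨fun P hP => ⟨hP.bijOn, ⟨2, hP.two_mem_superlinearSpeeds⟩, srptIsCompetitive hP hm⟩,
    fun α hα => ⟨srptRatio_rpow hα m, ?_⟩⟩
  rw [← srptRatio_rpow hα m]
  exact srptIsCompetitive (isPowerFunction_rpow hα) hm
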